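/- **Model.** Base stations (BSs) form a homogeneous Poisson point process $\Phi$ of intensity $\lambda>0$ in the plane, and user equipments (UEs) form an independent homogeneous Poisson point process of intensity $\rho>0$. Fix breakpoints $0<d_1<\dots<d_{N-1}$, $N\ge 1$. On the $n$-th piece ($r\le d_1$; $d_{n-1}<r\le d_n$; $r>d_{N-1}$) put $\zeta^{\rm L}(r)=A_n^{\rm L}r^{-\alpha_n^{\rm L}}$, $\zeta^{\rm NL}(r)=A_n^{\rm NL}r^{-\alpha_n^{\rm NL}}$ with positive constants, and ${\rm Pr}^{\rm L}(r)={\rm Pr}_n^{\rm L}(r)\in[0,1]$ with ${\rm Pr}^{\rm L}_n$ non-increasing on its piece; $\zeta^{\rm L}$ and $\zeta^{\rm NL}$ are strictly decreasing on $(0,\infty)$. Independently over all BS–UE pairs and given the positions, a link of length $r$ is LoS with probability ${\rm Pr}^{\rm L}(r)$, and its gain is then $\zeta^{\rm L}(r)$; otherwise it is NLoS with gain $\zeta^{\rm NL}(r)$. Each UE is associated with the BS with the largest gain (smallest path loss) to it. A BS is activated if at least one UE is associated with it. For $r>0$ let $r_1=r_1(r)$ and $r_2=r_2(r)$ be the solutions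 of $\zeta^{\rm NL}(r_1)=\zeta^{\rm L}(r)$ and $\zeta^{\rm L}(r_2)=\zeta^{\rm NL}(r)$; if a jump leaves no solution, $r_1=\sup\{u>0:\zeta^{\rm NL}(u)\ge\zeta^{\rm L}(r)\}$, and $r_2$ is defined likewise. Let $$f_R^{\rm L}(r)=e^{-\int_0^{r_1}(1-{\rm Pr}^{\rm L}(u))2\pi u\lambda\,du}\,e^{-\int_0^{r}{\rm Pr}^{\rm L}(u)2\pi u\lambda\,du}\,{\rm Pr}^{\rm L}(r)2\pi r\lambda,$$ $$f_R^{\rm NL}(r)=e^{-\int_0^{r_2}{\rm Pr}^{\rm L}(u)2\pi u\lambda\,du}\,e^{-\int_0^{r}(1-{\rm Pr}^{\rm L}(u))2\pi u\lambda\,du}\,(1-{\rm Pr}^{\rm L}(r))2\pi r\lambda,$$ and $F_R^{\rm L}(r)=\int_0^r f_R^{\rm L}(u)\,du$, $F_R^{\rm NL}(r)=\int_0^r f_R^{\rm NL}(u)\,du$. **Theorem.** (a) Add to $\Phi$ a tagged BS $b$ at the origin, and consider a UE $w$, whose links to $b$ and to the points of $\Phi$ are LoS or NLoS as above. If $w$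 is at distance $r>0$ from $b$, the probability that $w$ is not associated with $b$ is $${\rm Pr}[w\nsim b\mid r]=\left[F_R^{\rm L}(r)+F_R^{\rm NL}(r_1)\right]{\rm Pr}^{\rm L}(r)+\left[F_R^{\rm L}(r_2)+F_R^{\rm NL}(r)\right]\left[1-{\rm Pr}^{\rm L}(r)\right],$$ and if $w$ is uniformly distributed in the disk of radius $r_{\max}>0$ around $b$, it is $${\rm Pr}[w\nsim b]=\int_0^{r_{\max}}{\rm Pr}[w\nsim b\mid r]\,\frac{2r}{r_{\max}^2}\,dr.$$ (b) With $\lambda_\Omega=\rho\pi r_{\max}^2$, the limit $$Q^{\rm off}=\lim_{r_{\max}\to+\infty}\sum_{k=0}^{+\infty}\left\{{\rm Pr}[w\nsim b]\right\}^k\frac{\lambda_\Omega^k e^{-\lambda_\Omega}}{k!}$$ exists; the activated BSs have a density $\tilde\lambda$ (the expected number of activated BSs in every Borel set $B$ is $\tilde\lambda|B|$); and $$\tilde\lambda\le\lambda\left(1-Q^{\rm off}\right).$$ -/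

import Mathlib

open MeasureTheory ProbabilityTheory Filter Topology Set

noncomputable section

/-! ### The piecewise LoS / NLoS path loss model -/

/-- Index of the piece that contains the distance `r`: piece `0` is `r ≤ d 0`, piece `n` is
`d (n-1) < r ≤ d n`, and the last piece is `r > d (M-1)`. -/
def pieceIndex {M : ℕ} (d : Fin M → ℝ) (r : ℝ) : Fin (M + 1) :=
  ⟨(Finset.univ.filter fun i => d i < r).card, by
    have h := Finset.card_filter_le (Finset.univ : Finset (Fin M)) (fun i => d i < r)
    rw [Finset.card_univ, Fintype.card_fin] at h
    omega⟩

/-- The piecewise function with pieces `f 0, …, f M` and breakpoints `d 0 < … < d (M-1)`. -/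
def stacked {M : ℕ} (d : Fin M → ℝ) (f : Fin (M + 1) → ℝ → ℝ) (r : ℝ) : ℝ :=
  f (pieceIndex d r) r

/-- The path loss function `A r ^ (-α)` (a gain: a large value means a small loss). -/
def powerLaw (A α r : ℝ) : ℝ := A * r ^ (-α)

/-- A path loss model with `M + 1` pieces. -/
structure PathLossModel where
  /-- number of breakpoints -/
  M : ℕ
  /-- breakpoints -/
  d : Fin M → ℝ
  /-- path losses at the reference distance, and path loss exponents -/
  AL : Fin (M + 1) → ℝ
  ANL : Fin (M + 1) → ℝ
  αL : Fin (M + 1) → ℝ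
  αNL : Fin (M + 1) → ℝ
  /-- pieces of the LoS probability function -/
  prL : Fin (M + 1) → ℝ → ℝ
  d_pos : ∀ i, 0 < d i
  d_strictMono : StrictMono d
  AL_pos : ∀ n, 0 < AL n
  ANL_pos : ∀ n, 0 < ANL n
  αL_pos : ∀ n, 0 < αL n
  αNL_pos : ∀ n, 0 < αNL n
  prL_nonneg : ∀ n r, 0 ≤ r → pieceIndex d r = n → 0 ≤ prL n r
  prL_le_one : ∀ n r, 0 ≤ r → pieceIndex d r = n → prL n r ≤ 1
  prL_antitone : ∀ n, AntitoneOn (prL n) {r | 0 ≤ r ∧ pieceIndex d r = n}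
  /-- The received power decreases with the distance, also across the breakpoints. -/
  gainL_strictAnti : StrictAntiOn (stacked d fun n => powerLaw (AL n) (αL n)) (Ioi 0)
  gainNL_strictAnti : StrictAntiOn (stacked d fun n => powerLaw (ANL n) (αNL n)) (Ioi 0)

/-- The radius `u` at which the gain `g` has decreased to the level `c`. -/
def crossRadius (g : ℝ → ℝ) (c : ℝ) : ℝ := sSup {u | 0 < u ∧ c ≤ g u}

/-- `crossRadius g c` is the solution `s` of `g s = c` whenever there is one. -/
theorem crossRadius_eq {g : ℝ → ℝ} (hg : StrictAntiOn g (Ioi 0)) {c s : ℝ} (hs : 0 < s)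
    (h : g s = c) : crossRadius g c = s := by
  have hgr : IsGreatest {u | 0 < u ∧ c ≤ g u} s := by
    refine ⟨⟨hs, h.ge⟩, fun u hu => ?_⟩
    by_contra hlt
    have h1 := hg (mem_Ioi.2 hs) (mem_Ioi.2 hu.1) (not_le.1 hlt)
    have h2 := hu.2
    linarith
  exact hgr.csSup_eq

namespace PathLossModel

/-- The stacked LoS path loss function. -/
def gainL (m : PathLossModel) : ℝ → ℝ :=
  stacked m.d fun n => powerLaw (m.AL n) (m.αL n)

/-- The stacked NLoS path loss function. -/
def gainNL (m : PathLossModel) : ℝ → ℝ :=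
  stacked m.d fun n => powerLaw (m.ANL n) (m.αNL n)

/-- The stacked LoS probability function. -/
def losProb (m : PathLossModel) : ℝ → ℝ := stacked m.d m.prL

/-- `r₁`: the solution of `ζ^NL(r₁) = ζ^L(r)`. -/
def r1 (m : PathLossModel) (r : ℝ) : ℝ := crossRadius m.gainNL (m.gainL r)

/-- `r₂`: the solution of `ζ^L(r₂) = ζ^NL(r)`. -/
def r2 (m : PathLossModel) (r : ℝ) : ℝ := crossRadius m.gainL (m.gainNL r)

/-- The density `f_R^L` for BS density `lam`. -/
def fL (m : PathLossModel) (lam r : ℝ) : ℝ :=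
  Real.exp (-∫ u in (0 : ℝ)..m.r1 r, (1 - m.losProb u) * (2 * Real.pi * u * lam)) *
    Real.exp (-∫ u in (0 : ℝ)..r, m.losProb u * (2 * Real.pi * u * lam)) *
    (m.losProb r * (2 * Real.pi * r * lam))

/-- The density `f_R^NL` for BS density `lam`. -/
def fNL (m : PathLossModel) (lam r : ℝ) : ℝ :=
  Real.exp (-∫ u in (0 : ℝ)..m.r2 r, m.losProb u * (2 * Real.pi * u * lam)) *
    Real.exp (-∫ u in (0 : ℝ)..r, (1 - m.losProb u) * (2 * Real.pi * u * lam)) *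
    ((1 - m.losProb r) * (2 * Real.pi * r * lam))

/-- The CDF `F_R^L`. -/
def FL (m : PathLossModel) (lam r : ℝ) : ℝ := ∫ u in (0 : ℝ)..r, m.fL lam u

/-- The CDF `F_R^NL`. -/
def FNL (m : PathLossModel) (lam r : ℝ) : ℝ := ∫ u in (0 : ℝ)..r, m.fNL lam u

/-- The expression for `Pr[w ≁ b | r]`. -/
def notAssocGiven (m : PathLossModel) (lam r : ℝ) : ℝ :=
  (m.FL lam r + m.FNL lam (m.r1 r)) * m.losProb r +
    (m.FL lam (m.r2 r) + m.FNL lam r) * (1 - m.losProb r)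

/-- The expression for `Pr[w ≁ b]` with a UE uniformly placed in a disk of radius `rmax`. -/
def notAssoc (m : PathLossModel) (lam rmax : ℝ) : ℝ :=
  ∫ r in (0 : ℝ)..rmax, m.notAssocGiven lam r * (2 * r / rmax ^ 2)

/-- The expression whose limit as `rmax → ∞` is `Q^off`. -/
def qOff (m : PathLossModel) (lam rho rmax : ℝ) : ℝ :=
  ∑' k : ℕ, m.notAssoc lam rmax ^ k *
    ((rho * Real.pi * rmax ^ 2) ^ k * Real.exp (-(rho * Real.pi * rmax ^ 2)) / k.factorial)

end PathLossModel

/-! ### The network -/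

/-- The plane with its Euclidean distance. -/
abbrev Plane : Type := EuclideanSpace ℝ (Fin 2)

/-- The number of points of the process `X 0, X 1, …` in `B`. -/
def pointCount {Ω : Type*} (X : ℕ → Ω → Plane) (B : Set Plane) (ω : Ω) : ℕ∞ :=
  {i | X i ω ∈ B}.encard

/-- `X 0, X 1, …` is a measurable enumeration of the points of a homogeneous Poisson point
process of intensity `lam` on the plane. -/
structure IsHPPP {Ω : Type*} [MeasurableSpace Ω] (P : Measure Ω) (X : ℕ → Ω → Plane)
    (lam : ℝ) : Prop where
  measurable : ∀ i, Measurable (X i)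
  map_pointCount : ∀ B : Set Plane, MeasurableSet B → volume B ≠ ⊤ →
    P.map (pointCount X B) =
      (poissonMeasure (lam * volume.real B).toNNReal).map (fun k : ℕ => (k : ℕ∞))
  indep_pointCount : ∀ (n : ℕ) (B : Fin n → Set Plane), (∀ i, MeasurableSet (B i)) →
    Pairwise (fun i j => Disjoint (B i) (B j)) → iIndepFun (fun i => pointCount X (B i)) P

/-- The gain `ζ` of the link between a BS at `x` and a UE at `y` whose mark is `u`; for `u`
uniform on `[0,1]` the link is LoS with probability `losProb (dist x y)`. -/
def linkGain (m : PathLossModel) (x y : Plane) (u : unitInterval) : ℝ :=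
  if (u : ℝ) < m.losProb (dist x y) then m.gainL (dist x y) else m.gainNL (dist x y)

/-- BSs `X i` form an HPPP of intensity `lam`, UEs `Y j` an HPPP of intensity `rho`, and the links
(BS `i`, UE `j`) carry i.i.d. uniform marks `U i j`; all three families are independent. -/
structure IsNetwork {Ω : Type*} [MeasurableSpace Ω] (P : Measure Ω) (lam rho : ℝ)
    (X Y : ℕ → Ω → Plane) (U : ℕ → ℕ → Ω → unitInterval) : Prop where
  bs : IsHPPP P X lam
  ue : IsHPPP P Y rho
  mark_measurable : ∀ i j, Measurable (U i j)
  mark_uniform : ∀ i j, P.map (U i j) = volume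
  mark_indep : iIndepFun (fun p : ℕ × ℕ => U p.1 p.2) P
  indep_bs_ue : IndepFun (fun ω i => X i ω) (fun ω j => Y j ω) P
  indep_mark : IndepFun (fun ω => ((fun i => X i ω), (fun j => Y j ω)))
    (fun ω (p : ℕ × ℕ) => U p.1 p.2 ω) P

/-- UE `j` is connected to BS `i`, which has the largest `ζ` (the smallest path loss). -/
def IsAssociated {Ω : Type*} (m : PathLossModel) (X Y : ℕ → Ω → Plane)
    (U : ℕ → ℕ → Ω → unitInterval) (ω : Ω) (j i : ℕ) : Prop :=
  ∀ i', linkGain m (X i' ω) (Y j ω) (U i' j ω) ≤ linkGain m (X i ω) (Y j ω) (U i j ω)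

/-- The number of activated BSs in `B`, that is, of those with at least one connected UE. -/
def activatedCount {Ω : Type*} (m : PathLossModel) (X Y : ℕ → Ω → Plane)
    (U : ℕ → ℕ → Ω → unitInterval) (B : Set Plane) (ω : Ω) : ℕ∞ :=
  {i | X i ω ∈ B ∧ ∃ j, IsAssociated m X Y U ω j i}.encard

/-- `lamt` is the density (intensity) of the activated BSs. -/
def IsActivatedDensity {Ω : Type*} [MeasurableSpace Ω] (P : Measure Ω) (m : PathLossModel)
    (X Y : ℕ → Ω → Plane) (U : ℕ → ℕ → Ω → unitInterval) (lamt : ℝ) : Prop :=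
  0 ≤ lamt ∧ ∀ B : Set Plane, MeasurableSet B →
    ∫⁻ ω, (activatedCount m X Y U B ω : ENNReal) ∂P = ENNReal.ofReal lamt * volume B

/-! ### A tagged BS `b` at the origin and a tagged UE `w` -/

/-- The tagged UE at `w` is not associated with the tagged BS at the origin: one of the BSs
`x 0, x 1, …` offers a larger `ζ`. The link of `w` to the tagged BS has mark `v none`, and the link
to `x i` has mark `v (some i)`. -/
def TaggedNotAssoc (m : PathLossModel) (x : ℕ → Plane) (w : Plane)
    (v : Option ℕ → unitInterval) : Prop :=
  ∃ i, linkGain m 0 w (v none) < linkGain m (x i) w (v (some i))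

/-- The law of i.i.d. uniform marks. -/
def markLaw : Measure (Option ℕ → unitInterval) :=
  Measure.infinitePi fun _ => (volume : Measure unitInterval)

/-- `Pr[w ≁ b]` for a UE at the fixed location `w`. -/
def taggedProbAt {Ω : Type*} [MeasurableSpace Ω] (P : Measure Ω) (m : PathLossModel)
    (X : ℕ → Ω → Plane) (w : Plane) : ℝ :=
  (P.prod markLaw).real {p | TaggedNotAssoc m (fun i => X i p.1) w p.2}

/-- `Pr[w ≁ b]` for a UE uniformly placed in the disk of radius `rmax` around the tagged BS. -/
def taggedProbDisk {Ω : Type*} [MeasurableSpace Ω] (P : Measure Ω) (m : PathLossModel)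
    (X : ℕ → Ω → Plane) (rmax : ℝ) : ℝ :=
  (P.prod ((volume[|Metric.closedBall (0 : Plane) rmax]).prod markLaw)).real
    {p | TaggedNotAssoc m (fun i => X i p.1) p.2.1 p.2.2}

end

/-!
Write `N` for the point process of the base stations, seen as the random measure
`pointMeasure X = ∑ᵢ δ_{Xᵢ}`. Everything rests on two facts about a homogeneous Poisson process
which are derived here from the law and the independence of its counts: the Laplace functional
`E exp (-∫ t dN) = exp (-λ ∫ (1 - exp (-t)))` (`IsHPPP.lintegral_expNeg`) and Mecke's formula
`E ∑ᵢ F (Xᵢ, N - δ_{Xᵢ}) = λ ∫ E F (x, N) dx` (`IsHPPP.tsum_lintegral_reduced`).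

**The tagged BS.** Given that the link of `w` to the tagged BS has gain `c`, the UE `w` stays
associated with it if and only if no point of `N` offers a gain above `c`. The probabilities of
`gain ≤ c` multiply over the points, so the Laplace functional turns the association probability
into `exp (-ν (c, ∞))`, where `ν` is the mean measure of the gains that `w` sees (`axisMeasure`,
the sum of a LoS and a NLoS branch). The density `f_R^L` is the LoS branch of `ν` times
`exp (-ν (s, ∞))`, read in the distance coordinate, and likewise for `f_R^NL`. As `ν` has no atoms,
`∫_{s > c} exp (-ν (s, ∞)) dν(s) = 1 - exp (-ν (c, ∞))`, which gives
`F_R^L + F_R^NL = 1 - exp (-ν (c, ∞))` at the radii where the two gains cross the level `c`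
(`PathLossModel.FL_add_FNL`). Averaging over the two values of `c` gives the formula at a fixed
distance, and integrating over the disk gives the second one.

**The activated BSs.** Given the BSs, the UE process is thinned independently: the UE at `y` chooses
the BS `x` with probability `assocGiven m x y (N - δ_x)`. By the Laplace functional of the UEs, `x`
is activated with probability `1 - exp (-W)`, where `W = ρ ∫ assocGiven m x y (N - δ_x) dy`
(`activationProb`). Mecke's formula and stationarity then give the density
`λ (1 - E exp (-W))`, with `W` computed for an additional BS at the origin. Summing the Poisson
series shows that `Q^off = exp (-E W)` (`PathLossModel.tendsto_qOff`), and the bound is Jensen's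
inequality `exp (-E W) ≤ E exp (-W)` (`expNeg_lintegral_le`).

All probabilities are kept as `ℝ≥0∞`-valued integrals, so that no integrability has to be
checked; `expNeg` and `negLog` are the exponential and the logarithm in this setting.
-/

open scoped ENNReal

/-! ### Exponentials and logarithms on `[0, ∞]` -/

/-- The function `t ↦ exp (-t)` on `[0, ∞]`, with `expNeg ∞ = 0`. -/
noncomputable def expNeg (t : ℝ≥0∞) : ℝ≥0∞ := (EReal.exp (t : EReal))⁻¹

/-- The function `q ↦ -log q` on `[0, ∞]`, truncated to `0` for `q > 1`, with `negLog 0 = ∞`. On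
`[0, 1]` it is the inverse of `expNeg`. -/
noncomputable def negLog (q : ℝ≥0∞) : ℝ≥0∞ := (-ENNReal.log q).toENNReal

theorem expNeg_zero : expNeg 0 = 1 := by simp [expNeg]

theorem expNeg_top : expNeg ⊤ = 0 := by simp [expNeg]

theorem expNeg_ofReal {x : ℝ} (hx : 0 ≤ x) :
    expNeg (ENNReal.ofReal x) = ENNReal.ofReal (Real.exp (-x)) := by
  have h : ((ENNReal.ofReal x : ℝ≥0∞) : EReal) = (x : EReal) := by
    rw [EReal.coe_ennreal_ofReal, max_eq_left hx]
  rw [expNeg, h, EReal.exp_coe, ← ENNReal.ofReal_inv_of_pos (Real.exp_pos x), Real.exp_neg]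

theorem expNeg_eq_ofReal {t : ℝ≥0∞} (ht : t ≠ ∞) :
    expNeg t = ENNReal.ofReal (Real.exp (-t.toReal)) := by
  rw [← expNeg_ofReal ENNReal.toReal_nonneg, ENNReal.ofReal_toReal ht]

theorem continuous_expNeg : Continuous expNeg :=
  continuous_inv.comp (ENNReal.continuous_exp.comp continuous_coe_ennreal_ereal)

theorem measurable_expNeg : Measurable expNeg := continuous_expNeg.measurable

theorem expNeg_antitone : Antitone expNeg := fun a b h => by
  rw [expNeg, expNeg]
  exact ENNReal.inv_le_inv.2 (EReal.exp_monotone (EReal.coe_ennreal_le_coe_ennreal_iff.2 h))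

theorem expNeg_le_one (t : ℝ≥0∞) : expNeg t ≤ 1 :=
  (expNeg_antitone (zero_le (a := t))).trans expNeg_zero.le

theorem expNeg_ne_top (t : ℝ≥0∞) : expNeg t ≠ ∞ :=
  ne_top_of_le_ne_top ENNReal.one_ne_top (expNeg_le_one t)

theorem expNeg_add (a b : ℝ≥0∞) : expNeg (a + b) = expNeg a * expNeg b := by
  have h (t : ℝ≥0∞) : EReal.exp (t : EReal) ≠ 0 := by
    simp [EReal.exp_eq_zero_iff]
  rw [expNeg, expNeg, expNeg, EReal.coe_ennreal_add, EReal.exp_add,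
    ENNReal.mul_inv (Or.inl (h a)) (Or.inr (h b))]

theorem expNeg_sum {ι : Type*} (s : Finset ι) (t : ι → ℝ≥0∞) :
    expNeg (∑ i ∈ s, t i) = ∏ i ∈ s, expNeg (t i) := by
  classical
  induction s using Finset.induction_on with
  | empty => simp [expNeg_zero]
  | insert a s ha ih => rw [Finset.sum_insert ha, Finset.prod_insert ha, expNeg_add, ih]

theorem expNeg_nat_mul (n : ℕ) (t : ℝ≥0∞) : expNeg (n * t) = expNeg t ^ n := by
  have := expNeg_sum (Finset.range n) (fun _ => t)
  simpa using this

theorem expNeg_negLog {q : ℝ≥0∞} (hq : q ≤ 1) : expNeg (negLog q) = q := by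
  have h : 0 ≤ -ENNReal.log q := by
    rw [EReal.le_neg, neg_zero]
    exact ENNReal.log_le_zero_iff.2 hq
  rw [expNeg, negLog, EReal.coe_toENNReal h, EReal.exp_neg, ENNReal.exp_log, inv_inv]

theorem negLog_one : negLog 1 = 0 := by simp [negLog]

theorem measurable_negLog : Measurable negLog :=
  measurable_ereal_toENNReal.comp (measurable_neg.comp ENNReal.measurable_log)

theorem hasProd_expNeg {ι : Type*} (t : ι → ℝ≥0∞) :
    HasProd (fun i => expNeg (t i)) (expNeg (∑' i, t i)) := by
  have h : HasSum t (∑' i, t i) := ENNReal.summable.hasSum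
  have h2 := (continuous_expNeg.tendsto _).comp h
  refine h2.congr fun s => ?_
  exact expNeg_sum s t

/-! ### Infinite product measures -/

/-- Independence over countably many coordinates, with the infinite product of probabilities
written as `expNeg` of a sum, which is the form the Laplace functional takes. -/
theorem infinitePi_univ_pi {ι : Type*} [Countable ι] {E : ι → Type*} [∀ i, MeasurableSpace (E i)]
    (μ : ∀ i, Measure (E i)) [∀ i, IsProbabilityMeasure (μ i)] {T : ∀ i, Set (E i)}
    (hT : ∀ i, MeasurableSet (T i)) :
    Measure.infinitePi μ (Set.univ.pi T) = expNeg (∑' i, negLog (μ i (T i))) := by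
  rw [Measure.infinitePi_pi_univ μ hT, ← (hasProd_expNeg _).tprod_eq]
  exact tprod_congr fun i => (expNeg_negLog prob_le_one).symm

/-- Resampling one coordinate preserves the product measure. -/
theorem infinitePi_map_update {ι E : Type*} [DecidableEq ι] [MeasurableSpace E]
    (μ : Measure E) [IsProbabilityMeasure μ] (i : ι) :
    (μ.prod (Measure.infinitePi fun _ : ι => μ)).map (fun p => Function.update p.2 i p.1) =
      Measure.infinitePi fun _ : ι => μ := by
  have hm : Measurable (fun p : E × (ι → E) => Function.update p.2 i p.1) := by
    refine measurable_pi_iff.2 fun k => ?_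
    by_cases hk : k = i
    · subst hk; simpa using measurable_fst
    · simp only [Function.update_of_ne hk]; fun_prop
  refine Measure.eq_infinitePi (fun _ : ι => μ) fun s t ht => ?_
  rw [Measure.map_apply hm (MeasurableSet.pi s.countable_toSet fun k _ => ht k)]
  have hpre : (fun p : E × (ι → E) => Function.update p.2 i p.1) ⁻¹' (Set.pi (s : Set ι) t) =
      (if i ∈ s then t i else univ) ×ˢ Set.pi ((s.erase i : Finset ι) : Set ι) t := by
    ext p
    simp only [mem_preimage, Set.mem_pi, Finset.mem_coe, mem_prod, Finset.mem_erase]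
    constructor
    · intro h
      refine ⟨?_, fun k hk => ?_⟩
      · split_ifs with hi
        · simpa using h i hi
        · trivial
      · simpa [hk.1] using h k hk.2
    · rintro ⟨h1, h2⟩ k hk
      by_cases hki : k = i
      · subst hki; simpa [hk] using h1
      · simpa [hki] using h2 k ⟨hki, hk⟩
  rw [hpre, Measure.prod_prod, Measure.infinitePi_pi _ (fun k _ => ht k)]
  split_ifs with hi
  · rw [Finset.mul_prod_erase s (fun k => μ (t k)) hi]
  · rw [measure_univ, one_mul, Finset.erase_eq_of_notMem hi]

/-- Condition on coordinate `i`: the other coordinates independently stay in sets that depend on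
it. -/
theorem infinitePi_forall_of_coord {ι E : Type*} [Countable ι] [MeasurableSpace E]
    (μ : Measure E) [IsProbabilityMeasure μ] (i : ι) {T : ι → Set (E × E)}
    (hT : ∀ k, MeasurableSet (T k)) :
    (Measure.infinitePi fun _ : ι => μ) {v | ∀ k, k ≠ i → (v i, v k) ∈ T k} =
      ∫⁻ u, expNeg (∑' k : {k // k ≠ i}, negLog (μ {a | (u, a) ∈ T k})) ∂μ := by
  classical
  have hm : Measurable (fun p : E × (ι → E) => Function.update p.2 i p.1) := by
    refine measurable_pi_iff.2 fun k => ?_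
    by_cases hk : k = i
    · subst hk; simpa using measurable_fst
    · simp only [Function.update_of_ne hk]; fun_prop
  have hS : MeasurableSet {v : ι → E | ∀ k, k ≠ i → (v i, v k) ∈ T k} := by
    have : {v : ι → E | ∀ k, k ≠ i → (v i, v k) ∈ T k} =
        ⋂ k, ⋂ (_ : k ≠ i), (fun v : ι → E => (v i, v k)) ⁻¹' T k := by ext v; simp
    rw [this]
    exact MeasurableSet.iInter fun k => MeasurableSet.iInter fun _ =>
      (by fun_prop : Measurable fun v : ι → E => (v i, v k)) (hT k)
  rw [← infinitePi_map_update μ i, Measure.map_apply hm hS, Measure.prod_apply (hm hS)]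
  refine lintegral_congr fun u => ?_
  have hset : Prod.mk u ⁻¹' ((fun p : E × (ι → E) => Function.update p.2 i p.1) ⁻¹'
      {v : ι → E | ∀ k, k ≠ i → (v i, v k) ∈ T k}) =
      Set.univ.pi fun k => if k = i then univ else {a | (u, a) ∈ T k} := by
    ext v
    simp only [mem_preimage, mem_ofPred_eq, Function.update_self, Set.mem_pi, mem_univ,
      forall_true_left]
    refine forall_congr' fun k => ?_
    by_cases hk : k = i <;> simp [hk]
  rw [hset, infinitePi_univ_pi]
  · congr 1
    refine Eq.trans (tsum_congr fun k => ?_)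
      (tsum_subtype {k | k ≠ i} (fun k => negLog (μ {a | (u, a) ∈ T k}))).symm
    by_cases hk : k = i <;> simp [hk, negLog_one]
  · intro k
    split_ifs
    · exact MeasurableSet.univ
    · exact measurable_prodMk_left (hT k)

/-! ### Point measures and the Laplace functional of a Poisson process -/

/-- The counting measure `∑ᵢ δ_{xᵢ}` of a family of points, with multiplicity. -/
noncomputable def pointMeasure {ι : Type*} (x : ι → Plane) : Measure Plane :=
  Measure.sum fun i => Measure.dirac (x i)

theorem lintegral_pointMeasure {ι : Type*} (x : ι → Plane) {f : Plane → ℝ≥0∞}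
    (hf : Measurable f) : ∫⁻ z, f z ∂(pointMeasure x) = ∑' i, f (x i) := by
  rw [pointMeasure, lintegral_sum_measure]
  exact tsum_congr fun i => lintegral_dirac' _ hf

theorem tsum_indicator_one_eq_encard {ι : Type*} (s : Set ι) :
    ∑' i, s.indicator (fun _ => (1 : ℝ≥0∞)) i = s.encard := by
  rw [← tsum_subtype, ENNReal.tsum_set_one]

theorem pointMeasure_apply {ι : Type*} (x : ι → Plane) {B : Set Plane} (hB : MeasurableSet B) :
    pointMeasure x B = ({i | x i ∈ B}.encard : ℝ≥0∞) := by
  rw [← lintegral_indicator_one hB, lintegral_pointMeasure x (measurable_one.indicator hB),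
    ← tsum_indicator_one_eq_encard]
  rfl

theorem measurable_encard_setOf {ι Ω : Type*} [Countable ι] [MeasurableSpace Ω] {p : ι → Ω → Prop}
    (hp : ∀ i, MeasurableSet {ω | p i ω}) : Measurable fun ω => {i | p i ω}.encard := by
  have h : Measurable fun ω => (({i | p i ω}.encard : ℕ∞) : ℝ≥0∞) := by
    simp_rw [← tsum_indicator_one_eq_encard]
    refine Measurable.tsum fun i => ?_
    have : (fun ω => {i | p i ω}.indicator (fun _ => (1 : ℝ≥0∞)) i) =
        {ω | p i ω}.indicator fun _ => 1 := rfl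
    rw [this]
    exact measurable_const.indicator (hp i)
  refine measurable_to_countable' fun n => ?_
  have h2 := h (measurableSet_singleton (n : ℝ≥0∞))
  convert h2 using 1
  ext ω
  simp

theorem measurable_pointMeasure {ι Ω : Type*} [Countable ι] [MeasurableSpace Ω]
    {X : ι → Ω → Plane} (hX : ∀ i, Measurable (X i)) :
    Measurable fun ω => pointMeasure fun i => X i ω := by
  refine Measure.measurable_of_measurable_coe _ fun B hB => ?_
  simp_rw [pointMeasure_apply _ hB]
  exact (measurable_of_countable _).comp (measurable_encard_setOf fun i => hX i hB)

theorem lintegral_finsetProd_of_iIndepFun {ι Ω : Type*} [MeasurableSpace Ω] {P : Measure Ω}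
    [IsProbabilityMeasure P] {g : ι → Ω → ℝ≥0∞} (hg : ∀ i, Measurable (g i)) (h : iIndepFun g P)
    (s : Finset ι) : ∫⁻ ω, ∏ i ∈ s, g i ω ∂P = ∏ i ∈ s, ∫⁻ ω, g i ω ∂P := by
  classical
  induction s using Finset.induction_on with
  | empty => simp
  | insert a s ha ih =>
    rw [Finset.prod_insert ha, ← ih,
      ← lintegral_mul_eq_lintegral_mul_lintegral_of_indepFun (hg a)
        (Finset.measurable_prod s fun i _ => hg i)]
    · simp [Finset.prod_insert ha]
    · have := h.indepFun_finsetProd_of_notMem hg ha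
      refine this.symm.congr (ae_of_all _ fun _ => rfl) (ae_of_all _ fun ω => ?_)
      simp

theorem lintegral_poissonMeasure (r : NNReal) (f : ℕ → ℝ≥0∞) :
    ∫⁻ n, f n ∂(poissonMeasure r) =
      ∑' n : ℕ, ENNReal.ofReal (Real.exp (-r) * r ^ n / n.factorial) * f n := by
  rw [poissonMeasure, lintegral_sum_measure]
  simp

theorem lintegral_expNeg_poissonMeasure (r : NNReal) (c : ℝ≥0∞) :
    ∫⁻ n : ℕ, expNeg (c * n) ∂(poissonMeasure r) = expNeg (r * (1 - expNeg c)) := by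
  obtain ⟨q, hq⟩ : ∃ q : NNReal, (q : ℝ≥0∞) = expNeg c :=
    ⟨_, ENNReal.coe_toNNReal (expNeg_ne_top c)⟩
  have hq1 : q ≤ 1 := by
    have := expNeg_le_one c
    rw [← hq] at this
    exact_mod_cast this
  have hR : (r : ℝ≥0∞) * (1 - expNeg c) = ENNReal.ofReal (r * (1 - q)) := by
    rw [← hq, ENNReal.ofReal_mul r.coe_nonneg, ENNReal.ofReal_coe_nnreal,
      ENNReal.ofReal_sub _ q.coe_nonneg]
    simp
  have hs : HasSum (fun n : ℕ => Real.exp (-r) * r ^ n / n.factorial * q ^ n)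
      (Real.exp (-(r * (1 - q)))) := by
    have h := (NormedSpace.expSeries_div_hasSum_exp ((r * q : ℝ))).mul_left (Real.exp (-r))
    rw [← Real.exp_eq_exp_ℝ, ← Real.exp_add] at h
    have e1 : -(r * (1 - q) : ℝ) = -r + r * q := by ring
    rw [e1]
    refine h.congr_fun fun n => ?_
    rw [mul_pow]; ring
  rw [lintegral_poissonMeasure, hR,
    expNeg_ofReal (mul_nonneg r.coe_nonneg (sub_nonneg.2 (by exact_mod_cast hq1))),
    ← hs.tsum_eq, ENNReal.ofReal_tsum_of_nonneg (fun n => by positivity) hs.summable]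
  refine tsum_congr fun n => ?_
  rw [mul_comm c, expNeg_nat_mul, ← hq, ENNReal.ofReal_mul (by positivity)]
  congr 1
  rw [ENNReal.ofReal_pow q.coe_nonneg, ENNReal.ofReal_coe_nnreal]

namespace IsHPPP

variable {Ω : Type*} [MeasurableSpace Ω] {P : Measure Ω} {X : ℕ → Ω → Plane} {lam : ℝ}

theorem measurable_pointCount (h : IsHPPP P X lam) {B : Set Plane} (hB : MeasurableSet B) :
    Measurable (pointCount X B) :=
  measurable_encard_setOf fun i => h.measurable i hB

theorem iIndepFun_pointCount (h : IsHPPP P X lam) {ι : Type*} [Fintype ι] {A : ι → Set Plane}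
    (hA : ∀ i, MeasurableSet (A i)) (hd : Pairwise fun i j => Disjoint (A i) (A j)) :
    iIndepFun (fun i => pointCount X (A i)) P := by
  have e := Fintype.equivFin ι
  have h1 := h.indep_pointCount (Fintype.card ι) (fun k => A (e.symm k)) (fun k => hA _)
    (fun i j hij => hd (e.symm.injective.ne hij))
  have h2 := h1.precomp e.injective
  simpa using h2

theorem lintegral_expNeg_mul_pointCount (h : IsHPPP P X lam) (hlam : 0 ≤ lam) {B : Set Plane}
    (hB : MeasurableSet B) (hv : volume B ≠ ⊤) (c : ℝ≥0∞) :
    ∫⁻ ω, expNeg (c * (pointCount X B ω : ℝ≥0∞)) ∂P =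
      expNeg (ENNReal.ofReal lam * ((1 - expNeg c) * volume B)) := by
  have hm : Measurable fun n : ℕ∞ => expNeg (c * (n : ℝ≥0∞)) := measurable_of_countable _
  have h1 := lintegral_map (μ := P) hm (h.measurable_pointCount hB)
  rw [← h1, h.map_pointCount B hB hv, lintegral_map hm (measurable_of_countable _)]
  simp only [ENat.toENNReal_coe]
  rw [lintegral_expNeg_poissonMeasure]
  congr 1
  rw [mul_comm (1 - expNeg c), ← mul_assoc]
  congr 1
  rw [← ENNReal.ofReal_toReal hv, ← ENNReal.ofReal_mul hlam]
  rfl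

/-- The Laplace functional for simple functions: independence of the counts in the level sets. -/
theorem lintegral_expNeg_simpleFunc [IsProbabilityMeasure P] (h : IsHPPP P X lam) (hlam : 0 ≤ lam)
    (f : SimpleFunc Plane ℝ≥0∞) (hf : ∀ c, c ≠ 0 → volume (f ⁻¹' {c}) ≠ ⊤) :
    ∫⁻ ω, expNeg (∫⁻ z, f z ∂(pointMeasure fun i => X i ω)) ∂P =
      expNeg (ENNReal.ofReal lam * ∫⁻ z, (1 - expNeg (f z))) := by
  classical
  set S := f.range.filter (· ≠ 0) with hS
  have hA (c : S) : MeasurableSet (f ⁻¹' {(c : ℝ≥0∞)}) := f.measurableSet_fiber c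
  have hind : iIndepFun (fun c : S => pointCount X (f ⁻¹' {(c : ℝ≥0∞)})) P := by
    refine h.iIndepFun_pointCount hA fun c d hcd => ?_
    exact Disjoint.preimage f (disjoint_singleton.2 fun hc => hcd (Subtype.ext hc))
  have hind2 : iIndepFun (fun (c : S) ω =>
      expNeg (c * (pointCount X (f ⁻¹' {(c : ℝ≥0∞)}) ω : ℝ≥0∞))) P :=
    hind.comp (fun (c : S) (n : ℕ∞) => expNeg (c * (n : ℝ≥0∞))) fun c => measurable_of_countable _
  have hmeas (c : S) : Measurable fun ω =>
      expNeg (c * (pointCount X (f ⁻¹' {(c : ℝ≥0∞)}) ω : ℝ≥0∞)) :=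
    (measurable_of_countable fun n : ℕ∞ => expNeg (c * (n : ℝ≥0∞))).comp
      (h.measurable_pointCount (hA c))
  have hL (ω : Ω) : ∫⁻ z, f z ∂(pointMeasure fun i => X i ω) =
      ∑ c : S, c * (pointCount X (f ⁻¹' {(c : ℝ≥0∞)}) ω : ℝ≥0∞) := by
    rw [SimpleFunc.lintegral_eq_lintegral f, SimpleFunc.lintegral,
      Finset.sum_coe_sort S (fun c => c * (pointCount X (f ⁻¹' {c}) ω : ℝ≥0∞)), hS,
      Finset.sum_filter]
    refine Finset.sum_congr rfl fun c _ => ?_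
    rw [pointMeasure_apply _ (f.measurableSet_fiber c)]
    by_cases hc : c = 0
    · simp [hc]
    · rw [if_pos hc]; rfl
  have hRr : ∫⁻ z, (1 - expNeg (f z)) =
      ∑ c : S, (1 - expNeg c) * volume (f ⁻¹' {(c : ℝ≥0∞)}) := by
    have := SimpleFunc.map_lintegral (μ := (volume : Measure Plane)) (fun c => 1 - expNeg c) f
    rw [← SimpleFunc.lintegral_eq_lintegral] at this
    simp only [SimpleFunc.coe_map, Function.comp_apply] at this
    rw [this, Finset.sum_coe_sort S (fun c => (1 - expNeg c) * volume (f ⁻¹' {c})), hS,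
      Finset.sum_filter]
    refine Finset.sum_congr rfl fun c _ => ?_
    by_cases hc : c = 0
    · simp [hc, expNeg_zero]
    · rw [if_pos hc]
  simp_rw [hL, expNeg_sum]
  rw [lintegral_finsetProd_of_iIndepFun hmeas hind2, hRr, Finset.mul_sum, expNeg_sum]
  refine Finset.prod_congr rfl fun c _ => ?_
  refine h.lintegral_expNeg_mul_pointCount hlam (hA c) (hf c ?_) c
  exact (Finset.mem_filter.1 c.2).2

/-- The **Laplace functional** of a homogeneous Poisson point process. -/
theorem lintegral_expNeg [IsProbabilityMeasure P] (h : IsHPPP P X lam) (hlam : 0 ≤ lam)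
    {t : Plane → ℝ≥0∞} (ht : Measurable t) :
    ∫⁻ ω, expNeg (∫⁻ z, t z ∂(pointMeasure fun i => X i ω)) ∂P =
      expNeg (ENNReal.ofReal lam * ∫⁻ z, (1 - expNeg (t z))) := by
  have hb (n : ℕ) : MeasurableSet (Metric.ball (0 : Plane) n) := Metric.isOpen_ball.measurableSet
  let f : ℕ → SimpleFunc Plane ℝ≥0∞ := fun n =>
    (SimpleFunc.eapprox t n).restrict (Metric.ball (0 : Plane) n)
  have hfa (n : ℕ) : ⇑(f n) = (Metric.ball (0 : Plane) n).indicator (SimpleFunc.eapprox t n) :=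
    SimpleFunc.coe_restrict _ (hb n)
  have hmono (z : Plane) : Monotone fun n => f n z := by
    intro a b hab
    simp only [hfa]
    refine (indicator_le_indicator (SimpleFunc.monotone_eapprox t hab z)).trans ?_
    exact indicator_le_indicator_of_subset (Metric.ball_subset_ball (by exact_mod_cast hab))
      (fun _ => zero_le) z
  have hlim (z : Plane) : Tendsto (fun n => f n z) atTop (𝓝 (t z)) := by
    refine (SimpleFunc.tendsto_eapprox ht z).congr' ?_
    obtain ⟨n, hn⟩ := exists_nat_gt (dist z 0)
    filter_upwards [eventually_ge_atTop n] with k hk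
    rw [hfa, indicator_of_mem]
    exact Metric.mem_ball.2 (hn.trans_le (by exact_mod_cast hk))
  have hfin (n : ℕ) (c : ℝ≥0∞) (hc : c ≠ 0) : volume (f n ⁻¹' {c}) ≠ ⊤ := by
    refine ne_top_of_le_ne_top (measure_ball_lt_top (x := (0 : Plane)) (r := n)).ne
      (measure_mono fun z hz => ?_)
    by_contra hz2
    refine hc ?_
    rw [← (mem_singleton_iff.1 hz : f n z = c), hfa, indicator_of_notMem hz2]
  have hL : Tendsto (fun n => ∫⁻ ω, expNeg (∫⁻ z, f n z ∂(pointMeasure fun i => X i ω)) ∂P) atTop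
      (𝓝 (∫⁻ ω, expNeg (∫⁻ z, t z ∂(pointMeasure fun i => X i ω)) ∂P)) := by
    refine tendsto_lintegral_of_dominated_convergence (fun _ => 1) (fun n => ?_)
      (fun n => ae_of_all _ fun ω => expNeg_le_one _) (by simp) (ae_of_all _ fun ω => ?_)
    · exact measurable_expNeg.comp ((Measure.measurable_lintegral (f n).measurable).comp
        (measurable_pointMeasure h.measurable))
    · refine (continuous_expNeg.tendsto _).comp ?_
      exact lintegral_tendsto_of_tendsto_of_monotone (fun n => (f n).measurable.aemeasurable)
        (ae_of_all _ hmono) (ae_of_all _ hlim)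
  have hRr : Tendsto (fun n => expNeg (ENNReal.ofReal lam * ∫⁻ z, (1 - expNeg (f n z)))) atTop
      (𝓝 (expNeg (ENNReal.ofReal lam * ∫⁻ z, (1 - expNeg (t z))))) := by
    refine (continuous_expNeg.tendsto _).comp ?_
    refine ENNReal.Tendsto.const_mul ?_ (Or.inr ENNReal.ofReal_ne_top)
    refine lintegral_tendsto_of_tendsto_of_monotone (fun n => ?_) (ae_of_all _ fun z => ?_)
      (ae_of_all _ fun z => ?_)
    · exact (measurable_const.sub (measurable_expNeg.comp (f n).measurable)).aemeasurable
    · exact fun a b hab => tsub_le_tsub_left (expNeg_antitone (hmono z hab)) 1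
    · exact ENNReal.Tendsto.sub tendsto_const_nhds
        ((continuous_expNeg.tendsto _).comp (hlim z)) (Or.inl ENNReal.one_ne_top)
  simp_rw [h.lintegral_expNeg_simpleFunc hlam (f _) (hfin _)] at hL
  exact tendsto_nhds_unique hL hRr

end IsHPPP

/-! ### Mecke's formula and stationarity -/

theorem tsum_eq_add_tsum_ne {ι : Type*} (f : ι → ℝ≥0∞) (i : ι) :
    ∑' k, f k = f i + ∑' k : {k // k ≠ i}, f k := by
  have h := ENNReal.summable.tsum_add_tsum_compl (f := f) (s := {i}) ENNReal.summable
  rw [tsum_singleton] at h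
  exact h.symm

theorem pointMeasure_eq_dirac_add {ι : Type*} (x : ι → Plane) (i : ι) :
    pointMeasure x = Measure.dirac (x i) + pointMeasure fun k : {k // k ≠ i} => x k := by
  ext B hB
  rw [Measure.add_apply]
  simp only [pointMeasure, Measure.sum_apply _ hB]
  exact tsum_eq_add_tsum_ne (fun k => Measure.dirac (x k) B) i

theorem encard_eq_add_ite {ι : Type*} (x : ι → Plane) (i : ι) {B : Set Plane}
    (hB : MeasurableSet B) [Decidable (x i ∈ B)] :
    {k | x k ∈ B}.encard = {k : {k // k ≠ i} | x k ∈ B}.encard + if x i ∈ B then 1 else 0 := by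
  have h := congrArg (fun μ => μ B) (pointMeasure_eq_dirac_add x i)
  simp only [Measure.add_apply, pointMeasure_apply _ hB, Measure.dirac_apply' _ hB] at h
  rw [← ENat.toENNReal_inj, h, add_comm, ENat.toENNReal_add]
  split_ifs with hi <;> simp [hi]

/-- Finitely many sets are unions of cells of one finite partition of their union. -/
theorem exists_disjoint_refinement (t : Finset (Set Plane)) (hm : ∀ B ∈ t, MeasurableSet B)
    (hv : ∀ B ∈ t, volume B ≠ ⊤) :
    ∃ (σ : Type) (_ : Fintype σ) (A : σ → Set Plane) (I : Set Plane → Finset σ),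
      (∀ s, MeasurableSet (A s)) ∧ (∀ s, volume (A s) ≠ ⊤) ∧
      (Pairwise fun s s' => Disjoint (A s) (A s')) ∧ ∀ B ∈ t, B = ⋃ s ∈ I B, A s := by
  classical
  -- the cells record in which of the sets a point lies, and a point outside of all has no cell
  refine ⟨{s : t → Prop // ∃ k, s k}, inferInstance, fun s => {z | ∀ k : t, z ∈ k.1 ↔ s.1 k},
    fun B => Finset.univ.filter fun s => ∃ h : B ∈ t, s.1 ⟨B, h⟩, fun s => ?_, fun s => ?_, ?_, ?_⟩
  · have : {z : Plane | ∀ k : t, z ∈ k.1 ↔ s.1 k} =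
        ⋂ k : t, if s.1 k then k.1 else (k.1)ᶜ := by
      ext z
      simp only [mem_ofPred_eq, mem_iInter]
      refine forall_congr' fun k => ?_
      by_cases hk : s.1 k <;> simp [hk]
    beta_reduce
    rw [this]
    refine MeasurableSet.iInter fun k => ?_
    split_ifs
    · exact hm _ k.2
    · exact (hm _ k.2).compl
  · obtain ⟨k, hk⟩ := s.2
    exact ne_top_of_le_ne_top (hv _ k.2) (measure_mono fun z hz => (hz k).2 hk)
  · intro s s' hss
    rw [Set.disjoint_left]
    intro z hz hz'
    exact hss (Subtype.ext (funext fun k => propext ((hz k).symm.trans (hz' k))))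
  · intro B hB
    ext z
    simp only [Finset.mem_filter, Finset.mem_univ, true_and, mem_iUnion, exists_prop]
    constructor
    · intro hz
      exact ⟨⟨fun k => z ∈ k.1, ⟨B, hB⟩, hz⟩, ⟨hB, hz⟩, fun k => Iff.rfl⟩
    · rintro ⟨s, ⟨h, hs⟩, hz⟩
      exact (hz ⟨B, h⟩).2 hs

/-- The events that depend on the masses of finitely many sets of finite area, one condition for
each set. They are a π-system that generates the σ-algebra on measures. -/
def finiteAreaEvents : Set (Set (Measure Plane)) :=
  piiUnionInter
    (fun B => {s | MeasurableSet[(borel ℝ≥0∞).comap fun μ : Measure Plane => μ B] s})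
    {B | MeasurableSet B ∧ volume B ≠ ⊤}

theorem isPiSystem_finiteAreaEvents : IsPiSystem finiteAreaEvents :=
  isPiSystem_piiUnionInter _
    (fun B => @MeasurableSpace.isPiSystem_measurableSet _
      ((borel ℝ≥0∞).comap fun μ : Measure Plane => μ B)) _

theorem generateFrom_finiteAreaEvents :
    MeasurableSpace.generateFrom finiteAreaEvents =
      (Measure.instMeasurableSpace : MeasurableSpace (Measure Plane)) := by
  refine (generateFrom_piiUnionInter_measurableSet
    (fun B => (borel ℝ≥0∞).comap fun μ : Measure Plane => μ B) _).trans (le_antisymm ?_ ?_)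
  · refine iSup₂_le fun B hB => ?_
    rw [← measurable_iff_comap_le]
    have := Measure.measurable_coe hB.1
    rwa [← BorelSpace.measurable_eq (α := ℝ≥0∞)]
  · refine iSup₂_le fun B hB => ?_
    rw [← measurable_iff_comap_le, ← BorelSpace.measurable_eq (α := ℝ≥0∞)]
    have hU : ∀ μ : Measure Plane, μ B = ⨆ n : ℕ, μ (B ∩ Metric.ball 0 n) := by
      intro μ
      rw [← Directed.measure_iUnion]
      · rw [← inter_iUnion, Metric.iUnion_ball_nat, inter_univ]
      · refine Monotone.directed_le fun a b hab => inter_subset_inter_right _ ?_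
        exact Metric.ball_subset_ball (by exact_mod_cast hab)
    simp_rw [hU]
    refine Measurable.iSup fun n => ?_
    have hmem : B ∩ Metric.ball 0 (n : ℝ) ∈ {B : Set Plane | MeasurableSet B ∧ volume B ≠ ⊤} :=
      ⟨hB.inter Metric.isOpen_ball.measurableSet,
        ne_top_of_le_ne_top measure_ball_lt_top.ne (measure_mono inter_subset_right)⟩
    rw [measurable_iff_comap_le, BorelSpace.measurable_eq (α := ℝ≥0∞)]
    exact le_iSup₂ (f := fun (B : Set Plane)
      (_ : B ∈ {B : Set Plane | MeasurableSet B ∧ volume B ≠ ⊤}) =>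
        (borel ℝ≥0∞).comap fun μ : Measure Plane => μ B) _ hmem

/-- An event in `finiteAreaEvents` depends on the masses of finitely many disjoint sets, which can
be chosen to refine a given set `C`. -/
theorem exists_disjoint_of_mem_finiteAreaEvents {D : Set (Measure Plane)}
    (hD : D ∈ finiteAreaEvents) {C : Set Plane} (hC : MeasurableSet C) (hCv : volume C ≠ ⊤) :
    ∃ (σ : Type) (_ : Fintype σ) (A : σ → Set Plane) (J : Finset σ) (E : Set (σ → ℝ≥0∞)),
      (∀ s, MeasurableSet (A s)) ∧ (∀ s, volume (A s) ≠ ⊤) ∧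
      (Pairwise fun s s' => Disjoint (A s) (A s')) ∧ C = ⋃ s ∈ J, A s ∧
      ∀ μ : Measure Plane, μ ∈ D ↔ (fun s => μ (A s)) ∈ E := by
  classical
  obtain ⟨t, ht, f, hf, rfl⟩ := hD
  obtain ⟨σ, hσ, A, I, hAm, hAv, hd, hI⟩ := exists_disjoint_refinement (insert C t)
    (by simpa [hC] using fun B hB => (ht hB).1) (by simpa [hCv] using fun B hB => (ht hB).2)
  choose! T hT hTf using hf
  refine ⟨σ, hσ, A, I C, {v | ∀ B ∈ t, ∑ s ∈ I B, v s ∈ T B}, hAm, hAv, hd,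
    hI C (Finset.mem_insert_self _ _), fun μ => ?_⟩
  simp only [mem_iInter, mem_ofPred_eq]
  refine forall₂_congr fun B hB => ?_
  have hB' : μ B = ∑ s ∈ I B, μ (A s) := by
    conv_lhs => rw [hI B (Finset.mem_insert_of_mem hB)]
    exact measure_biUnion_finset (fun s _ s' _ hss => hd hss) fun s _ => hAm s
  rw [← hTf B hB, mem_preimage, hB']

theorem poissonMeasure_map_cast_top (r : NNReal) :
    (poissonMeasure r).map (fun k : ℕ => (k : ℕ∞)) {⊤} = 0 := by
  rw [Measure.map_apply (measurable_of_countable _) (measurableSet_singleton _)]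
  convert measure_empty (μ := poissonMeasure r)
  ext n
  simp

theorem poissonMeasure_map_cast_coe (r : NNReal) (n : ℕ) :
    (poissonMeasure r).map (fun k : ℕ => (k : ℕ∞)) {(n : ℕ∞)} =
      ENNReal.ofReal (Real.exp (-r) * r ^ n / n.factorial) := by
  rw [Measure.map_apply (measurable_of_countable _) (measurableSet_singleton _),
    ← poissonMeasure_singleton]
  congr 1
  ext k
  simp

/-- The recursion `(n + 1) p (n + 1) = r p n` of the Poisson weights, which is what makes Mecke's
formula true. -/
theorem succ_mul_poissonMeasure_map_cast (r : NNReal) (n : ℕ∞) :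
    ((n + 1 : ℕ∞) : ℝ≥0∞) * (poissonMeasure r).map (fun k : ℕ => (k : ℕ∞)) {n + 1} =
      r * (poissonMeasure r).map (fun k : ℕ => (k : ℕ∞)) {n} := by
  induction n using ENat.recTopCoe with
  | top => simp [poissonMeasure_map_cast_top]
  | coe n =>
    have h1 := poissonMeasure_map_cast_coe r (n + 1)
    push_cast at h1
    rw [h1, poissonMeasure_map_cast_coe]
    have h2 : (((n : ℕ∞) + 1 : ℕ∞) : ℝ≥0∞) = ENNReal.ofReal (n + 1 : ℝ) := by
      rw [ENNReal.ofReal_add (by positivity) zero_le_one]; simp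
    rw [h2, ← ENNReal.ofReal_mul (by positivity), ← ENNReal.ofReal_coe_nnreal (p := r),
      ← ENNReal.ofReal_mul r.coe_nonneg]
    congr 1
    rw [Nat.factorial_succ]
    push_cast
    field_simp
    ring

namespace IsHPPP

variable {Ω : Type*} [MeasurableSpace Ω] {P : Measure Ω} {X : ℕ → Ω → Plane} {lam : ℝ}

theorem map_counts (h : IsHPPP P X lam) {σ : Type*} [Fintype σ] {A : σ → Set Plane}
    (hA : ∀ s, MeasurableSet (A s)) (hv : ∀ s, volume (A s) ≠ ⊤)
    (hd : Pairwise fun s s' => Disjoint (A s) (A s')) :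
    P.map (fun ω s => pointCount X (A s) ω) = Measure.pi fun s =>
      (poissonMeasure (lam * volume.real (A s)).toNNReal).map (fun k : ℕ => (k : ℕ∞)) := by
  rw [(h.iIndepFun_pointCount hA hd).map_fun_eq_pi_map
    fun s => (h.measurable_pointCount (hA s)).aemeasurable]
  congr 1
  ext1 s
  exact h.map_pointCount _ (hA s) (hv s)

theorem measurable_counts (h : IsHPPP P X lam) {σ : Type*} {A : σ → Set Plane}
    (hA : ∀ s, MeasurableSet (A s)) : Measurable fun ω s => pointCount X (A s) ω :=
  measurable_pi_iff.2 fun s => h.measurable_pointCount (hA s)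

theorem measurable_reducedCounts (h : IsHPPP P X lam) {σ : Type*} {A : σ → Set Plane}
    (hA : ∀ s, MeasurableSet (A s)) (i : ℕ) :
    Measurable fun ω s => {k : {k // k ≠ i} | X k ω ∈ A s}.encard :=
  measurable_pi_iff.2 fun s => measurable_encard_setOf fun k => h.measurable k (hA s)

/-- Mecke's formula for one vector of counts: on the event `X i ∈ A s₀`, removing the point `X i`
lowers the count of `A s₀` by one, and there are `m s₀ + 1` such points. -/
theorem tsum_measure_reducedCounts_eq (h : IsHPPP P X lam) {σ : Type*}
    [Fintype σ] {A : σ → Set Plane}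
    (hA : ∀ s, MeasurableSet (A s)) (hv : ∀ s, volume (A s) ≠ ⊤)
    (hd : Pairwise fun s s' => Disjoint (A s) (A s')) (s₀ : σ) (m : σ → ℕ∞) :
    ∑' i, P {ω | X i ω ∈ A s₀ ∧ (fun s => {k : {k // k ≠ i} | X k ω ∈ A s}.encard) = m} =
      ENNReal.ofReal (lam * volume.real (A s₀)) * P {ω | (fun s => pointCount X (A s) ω) = m} := by
  classical
  -- the counts before the removal of the point in `A s₀`
  set m' : σ → ℕ∞ := Function.update m s₀ (m s₀ + 1) with hm'
  have hE (n : σ → ℕ∞) : MeasurableSet {ω | (fun s => pointCount X (A s) ω) = n} :=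
    h.measurable_counts hA (measurableSet_singleton n)
  have hset (i : ℕ) :
      {ω | X i ω ∈ A s₀ ∧ (fun s => {k : {k // k ≠ i} | X k ω ∈ A s}.encard) = m} =
        X i ⁻¹' A s₀ ∩ {ω | (fun s => pointCount X (A s) ω) = m'} := by
    ext ω
    simp only [mem_ofPred_eq, mem_inter_iff, mem_preimage]
    refine and_congr_right fun hi => ?_
    rw [funext_iff, funext_iff]
    refine forall_congr' fun s => ?_
    rw [pointCount, encard_eq_add_ite (fun k => X k ω) i (hA s)]
    by_cases hs : s = s₀
    · subst hs
      simp only [hm', Function.update_self, if_pos hi]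
      exact (ENat.add_left_injective_of_ne_top ENat.one_ne_top).eq_iff.symm
    · have : X i ω ∉ A s := fun hi' => Set.disjoint_left.1 (hd hs) hi' hi
      simp [hm', Function.update_of_ne hs, this]
  have hP (n : σ → ℕ∞) : P {ω | (fun s => pointCount X (A s) ω) = n} =
      ∏ s, (poissonMeasure (lam * volume.real (A s)).toNNReal).map (fun k : ℕ => (k : ℕ∞))
        {n s} := by
    rw [← Measure.pi_singleton, ← h.map_counts hA hv hd,
      Measure.map_apply (h.measurable_counts hA) (measurableSet_singleton n)]
    rfl
  have h1 : ∑' i, P (X i ⁻¹' A s₀ ∩ {ω | (fun s => pointCount X (A s) ω) = m'}) =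
      ((m s₀ + 1 : ℕ∞) : ℝ≥0∞) * P {ω | (fun s => pointCount X (A s) ω) = m'} := by
    have : ∀ i, P (X i ⁻¹' A s₀ ∩ {ω | (fun s => pointCount X (A s) ω) = m'}) =
        ∫⁻ ω in {ω | (fun s => pointCount X (A s) ω) = m'},
          {k | X k ω ∈ A s₀}.indicator (fun _ => 1) i ∂P := by
      intro i
      rw [← Measure.restrict_apply (h.measurable i (hA s₀)),
        ← lintegral_indicator_one (h.measurable i (hA s₀))]
      rfl
    simp_rw [this]
    rw [← lintegral_tsum]
    · simp_rw [tsum_indicator_one_eq_encard]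
      rw [← setLIntegral_const]
      refine setLIntegral_congr_fun (hE m') fun ω hω => ?_
      have := congrFun hω s₀
      simp only [hm', Function.update_self] at this
      rw [← this]; rfl
    · intro i
      have : (fun ω => {k | X k ω ∈ A s₀}.indicator (fun _ => (1 : ℝ≥0∞)) i) =
        (X i ⁻¹' A s₀).indicator fun _ => 1 := rfl
      rw [this]
      exact (measurable_const.indicator (h.measurable i (hA s₀))).aemeasurable
  simp_rw [hset]
  rw [h1, hP, hP, ← Finset.mul_prod_erase Finset.univ _ (Finset.mem_univ s₀),
    ← Finset.mul_prod_erase Finset.univ (fun s => (poissonMeasure _).map _ {m s})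
      (Finset.mem_univ s₀), ← mul_assoc, ← mul_assoc]
  congr 1
  · simp only [hm', Function.update_self]
    exact succ_mul_poissonMeasure_map_cast _ _
  · refine Finset.prod_congr rfl fun s hs => ?_
    rw [hm', Function.update_of_ne (Finset.ne_of_mem_erase hs)]

theorem tsum_measure_reducedCounts_mem (h : IsHPPP P X lam) {σ : Type*}
    [Fintype σ] {A : σ → Set Plane}
    (hA : ∀ s, MeasurableSet (A s)) (hv : ∀ s, volume (A s) ≠ ⊤)
    (hd : Pairwise fun s s' => Disjoint (A s) (A s')) (s₀ : σ) (E : Set (σ → ℕ∞)) :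
    ∑' i, P {ω | X i ω ∈ A s₀ ∧ (fun s => {k : {k // k ≠ i} | X k ω ∈ A s}.encard) ∈ E} =
      ENNReal.ofReal (lam * volume.real (A s₀)) * P {ω | (fun s => pointCount X (A s) ω) ∈ E} := by
  have key : (Measure.sum fun i => (P.restrict (X i ⁻¹' A s₀)).map
      fun ω s => {k : {k // k ≠ i} | X k ω ∈ A s}.encard) =
      ENNReal.ofReal (lam * volume.real (A s₀)) • P.map fun ω s => pointCount X (A s) ω := by
    refine Measure.ext_of_singleton fun m => ?_
    rw [Measure.sum_apply _ (measurableSet_singleton m), Measure.smul_apply,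
      Measure.map_apply (h.measurable_counts hA) (measurableSet_singleton m), smul_eq_mul]
    refine Eq.trans (tsum_congr fun i => ?_) (h.tsum_measure_reducedCounts_eq hA hv hd s₀ m)
    rw [Measure.map_apply (h.measurable_reducedCounts hA i) (measurableSet_singleton m),
      Measure.restrict_apply (h.measurable_reducedCounts hA i (measurableSet_singleton m)),
      inter_comm]
    rfl
  have hEm : MeasurableSet E := E.to_countable.measurableSet
  have := congrArg (fun μ => μ E) key
  simp only [Measure.sum_apply _ hEm, Measure.smul_apply, smul_eq_mul,
    Measure.map_apply (h.measurable_counts hA) hEm] at this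
  refine Eq.trans (tsum_congr fun i => ?_) this
  rw [Measure.map_apply (h.measurable_reducedCounts hA i) hEm,
      Measure.restrict_apply (h.measurable_reducedCounts hA i hEm), inter_comm]
  rfl

theorem measurable_pointMeasure (h : IsHPPP P X lam) :
    Measurable fun ω => pointMeasure fun i => X i ω :=
  _root_.measurable_pointMeasure h.measurable

theorem measurable_reducedPointMeasure (h : IsHPPP P X lam) (i : ℕ) :
    Measurable fun ω => pointMeasure fun k : {k // k ≠ i} => X k ω :=
  _root_.measurable_pointMeasure fun k : {k // k ≠ i} => h.measurable k

/-- **Mecke's formula** as an identity of measures: a point of the process, jointly with the other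
points, has the law of an independent point of the plane and the whole process. -/
theorem sum_map_reduced [IsProbabilityMeasure P] (h : IsHPPP P X lam) (hlam : 0 ≤ lam) :
    (Measure.sum fun i => P.map fun ω => (X i ω, pointMeasure fun k : {k // k ≠ i} => X k ω)) =
      (ENNReal.ofReal lam • volume).prod (P.map fun ω => pointMeasure fun i => X i ω) := by
  classical
  have hmi (i : ℕ) : Measurable fun ω => (X i ω, pointMeasure fun k : {k // k ≠ i} => X k ω) :=
    (h.measurable i).prodMk (h.measurable_reducedPointMeasure i)
  have : IsProbabilityMeasure (P.map fun ω => pointMeasure fun i => X i ω) :=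
    Measure.isProbabilityMeasure_map h.measurable_pointMeasure.aemeasurable
  symm
  refine Measure.prod_eq_generateFrom (C := {B | MeasurableSet B ∧ volume B ≠ ⊤})
    (D := finiteAreaEvents) ?_ generateFrom_finiteAreaEvents ?_ isPiSystem_finiteAreaEvents ?_ ?_ ?_
  · refine le_antisymm (MeasurableSpace.generateFrom_le fun B hB => hB.1) fun B hB => ?_
    have : B = ⋃ n : ℕ, B ∩ Metric.ball 0 n := by
      rw [← inter_iUnion, Metric.iUnion_ball_nat, inter_univ]
    rw [this]
    refine MeasurableSet.iUnion fun n => MeasurableSpace.measurableSet_generateFrom ?_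
    exact ⟨hB.inter Metric.isOpen_ball.measurableSet,
        ne_top_of_le_ne_top measure_ball_lt_top.ne (measure_mono inter_subset_right)⟩
  · intro B hB B' hB' _
    exact ⟨hB.1.inter hB'.1, ne_top_of_le_ne_top hB.2 (measure_mono inter_subset_left)⟩
  · refine ⟨fun n : ℕ => Metric.ball 0 n, fun n => ⟨Metric.isOpen_ball.measurableSet,
      measure_ball_lt_top.ne⟩, fun n => ?_, Metric.iUnion_ball_nat 0⟩
    rw [Measure.smul_apply, smul_eq_mul]
    exact ENNReal.mul_lt_top ENNReal.ofReal_lt_top measure_ball_lt_top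
  · refine ⟨fun _ => univ, fun _ => ⟨∅, by simp, fun _ => univ, by simp, by simp⟩, fun _ =>
      measure_lt_top _ _, iUnion_const _⟩
  · rintro C ⟨hC, hCv⟩ D hD
    have hDm : MeasurableSet D := by
      rw [← generateFrom_finiteAreaEvents]
      exact MeasurableSpace.measurableSet_generateFrom hD
    obtain ⟨σ, _, A, J, E, hAm, hAv, hd, hCA, hDE⟩ :=
      exists_disjoint_of_mem_finiteAreaEvents hD hC hCv
    let E' : Set (σ → ℕ∞) := {v | (fun s => (v s : ℝ≥0∞)) ∈ E}
    have hN (ω : Ω) : (pointMeasure fun i => X i ω) ∈ D ↔ (fun s => pointCount X (A s) ω) ∈ E' := by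
      exact (hDE _).trans
        (iff_of_eq (congrArg (· ∈ E) (funext fun s => pointMeasure_apply _ (hAm s))))
    have hNi (i : ℕ) (ω : Ω) : (pointMeasure fun k : {k // k ≠ i} => X k ω) ∈ D ↔
        (fun s => {k : {k // k ≠ i} | X k ω ∈ A s}.encard) ∈ E' := by
      exact (hDE _).trans
        (iff_of_eq (congrArg (· ∈ E) (funext fun s => pointMeasure_apply _ (hAm s))))
    have hmeasE (i : ℕ) (s : σ) : MeasurableSet
        {ω | X i ω ∈ A s ∧ (fun s => {k : {k // k ≠ i} | X k ω ∈ A s}.encard) ∈ E'} :=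
      (h.measurable i (hAm s)).inter
        (h.measurable_reducedCounts hAm i (E'.to_countable.measurableSet))
    rw [Measure.sum_apply _ (hC.prod hDm), Measure.map_apply h.measurable_pointMeasure hDm,
      Measure.smul_apply, smul_eq_mul]
    have h1 (i : ℕ) : P.map (fun ω => (X i ω, pointMeasure fun k : {k // k ≠ i} => X k ω))
          (C ×ˢ D) =
        ∑ s ∈ J, P {ω | X i ω ∈ A s ∧
          (fun s => {k : {k // k ≠ i} | X k ω ∈ A s}.encard) ∈ E'} := by
      rw [Measure.map_apply (hmi i) (hC.prod hDm), ← measure_biUnion_finset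
        (fun s _ s' _ hss => ?_) fun s _ => hmeasE i s]
      · congr 1
        ext ω
        simp only [mem_preimage, mem_prod, hNi, mem_iUnion, mem_ofPred_eq]
        rw [hCA]
        simp only [mem_iUnion]
        tauto
      · exact Set.disjoint_left.2 fun ω hω hω' => Set.disjoint_left.1 (hd hss) hω.1 hω'.1
    have h2 : P ((fun ω => pointMeasure fun i => X i ω) ⁻¹' D) =
        P {ω | (fun s => pointCount X (A s) ω) ∈ E'} := by
      congr 1
      ext ω
      exact hN ω
    have h3 : ENNReal.ofReal lam * volume C =
        ∑ s ∈ J, ENNReal.ofReal (lam * volume.real (A s)) := by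
      rw [hCA, measure_biUnion_finset (fun s _ s' _ hss => hd hss) fun s _ => hAm s, Finset.mul_sum]
      refine Finset.sum_congr rfl fun s _ => ?_
      rw [ENNReal.ofReal_mul hlam, ofReal_measureReal (hAv s)]
    simp_rw [h1]
    rw [h2, h3, Finset.sum_mul, Summable.tsum_finsetSum fun _ _ => ENNReal.summable]
    exact Finset.sum_congr rfl fun s _ => h.tsum_measure_reducedCounts_mem hAm hAv hd s E'

theorem tsum_lintegral_reduced [IsProbabilityMeasure P] (h : IsHPPP P X lam) (hlam : 0 ≤ lam)
    {F : Plane → Measure Plane → ℝ≥0∞} (hF : Measurable (Function.uncurry F)) :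
    ∑' i, ∫⁻ ω, F (X i ω) (pointMeasure fun k : {k // k ≠ i} => X k ω) ∂P =
      ENNReal.ofReal lam * ∫⁻ x, ∫⁻ ω, F x (pointMeasure fun i => X i ω) ∂P := by
  have hmi (i : ℕ) : Measurable fun ω => (X i ω, pointMeasure fun k : {k // k ≠ i} => X k ω) :=
    (h.measurable i).prodMk (h.measurable_reducedPointMeasure i)
  have : IsProbabilityMeasure (P.map fun ω => pointMeasure fun i => X i ω) :=
    Measure.isProbabilityMeasure_map h.measurable_pointMeasure.aemeasurable
  have h1 := congrArg (fun μ => ∫⁻ p, Function.uncurry F p ∂μ) (h.sum_map_reduced hlam)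
  simp only [lintegral_sum_measure] at h1
  rw [lintegral_prod _ hF.aemeasurable, lintegral_smul_measure, smul_eq_mul] at h1
  refine (tsum_congr fun i => (lintegral_map hF (hmi i)).symm).trans (h1.trans ?_)
  congr 1
  refine lintegral_congr fun x => ?_
  exact lintegral_map (hF.comp measurable_prodMk_left) h.measurable_pointMeasure

theorem map_pointMeasure_apply (h : IsHPPP P X lam) {σ : Type*} [Fintype σ] {A : σ → Set Plane}
    (hA : ∀ s, MeasurableSet (A s)) (hv : ∀ s, volume (A s) ≠ ⊤)
    (hd : Pairwise fun s s' => Disjoint (A s) (A s')) {D : Set (Measure Plane)}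
    (hD : MeasurableSet D) {E : Set (σ → ℝ≥0∞)}
    (hDE : ∀ μ : Measure Plane, μ ∈ D ↔ (fun s => μ (A s)) ∈ E) :
    P.map (fun ω => pointMeasure fun i => X i ω) D =
      (Measure.pi fun s =>
        (poissonMeasure (lam * volume.real (A s)).toNNReal).map (fun k : ℕ => (k : ℕ∞)))
        {v | (fun s => (v s : ℝ≥0∞)) ∈ E} := by
  rw [← h.map_counts hA hv hd, Measure.map_apply h.measurable_pointMeasure hD,
    Measure.map_apply (h.measurable_counts hA) (Set.to_countable _).measurableSet]
  congr 1
  ext ω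
  exact (hDE _).trans (iff_of_eq (congrArg (· ∈ E) (funext fun s => pointMeasure_apply _ (hA s))))

theorem map_pointMeasure_eq {Ω' : Type*} [MeasurableSpace Ω'] {P' : Measure Ω'}
    {X' : ℕ → Ω' → Plane} [IsProbabilityMeasure P] [IsProbabilityMeasure P']
    (h : IsHPPP P X lam) (h' : IsHPPP P' X' lam) :
    P.map (fun ω => pointMeasure fun i => X i ω) =
      P'.map fun ω => pointMeasure fun i => X' i ω := by
  have : IsProbabilityMeasure (P.map fun ω => pointMeasure fun i => X i ω) :=
    Measure.isProbabilityMeasure_map h.measurable_pointMeasure.aemeasurable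
  have : IsProbabilityMeasure (P'.map fun ω => pointMeasure fun i => X' i ω) :=
    Measure.isProbabilityMeasure_map h'.measurable_pointMeasure.aemeasurable
  refine ext_of_generate_finite finiteAreaEvents generateFrom_finiteAreaEvents.symm
    isPiSystem_finiteAreaEvents (fun D hD => ?_) (by simp)
  have hDm : MeasurableSet D := by
    rw [← generateFrom_finiteAreaEvents]
    exact MeasurableSpace.measurableSet_generateFrom hD
  obtain ⟨σ, _, A, J, E, hAm, hAv, hd, -, hDE⟩ :=
    exists_disjoint_of_mem_finiteAreaEvents hD MeasurableSet.empty (by simp)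
  rw [h.map_pointMeasure_apply hAm hAv hd hDm hDE, h'.map_pointMeasure_apply hAm hAv hd hDm hDE]

theorem translate (h : IsHPPP P X lam) (a : Plane) : IsHPPP P (fun i ω => X i ω - a) lam where
  measurable i := (h.measurable i).sub_const a
  map_pointCount B hB hv := by
    have hpc : pointCount (fun i ω => X i ω - a) B = pointCount X ((fun z => z - a) ⁻¹' B) := rfl
    have hvol : volume ((fun z => z - a) ⁻¹' B) = volume B :=
      (measurePreserving_sub_right volume a).measure_preimage hB.nullMeasurableSet
    rw [hpc, h.map_pointCount _ ((measurable_sub_const a) hB) (by rwa [hvol]), measureReal_def,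
      hvol]
    rfl
  indep_pointCount n B hB hd :=
    h.indep_pointCount n (fun i => (fun z => z - a) ⁻¹' B i)
      (fun i => measurable_sub_const a (hB i)) fun i j hij => (hd hij).preimage _

end IsHPPP

/-! ### Measurability and inversion of the gains -/

theorem measurable_pieceIndex {M : ℕ} (d : Fin M → ℝ) : Measurable (pieceIndex d) := by
  have h : Measurable fun r : ℝ => (Finset.univ.filter fun i => d i < r).card := by
    simp_rw [Finset.card_filter]
    refine Finset.measurable_sum _ fun i _ => ?_
    exact Measurable.ite measurableSet_Ioi measurable_const measurable_const
  refine measurable_to_countable' fun n => ?_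
  convert h (measurableSet_singleton n.val) using 1
  ext r
  simp [pieceIndex, Fin.ext_iff]

theorem measurable_stacked {M : ℕ} (d : Fin M → ℝ) {f : Fin (M + 1) → ℝ → ℝ}
    (hf : ∀ n, Measurable (f n)) : Measurable (stacked d f) := by
  have h : Measurable fun p : Fin (M + 1) × ℝ => f p.1 p.2 :=
    measurable_from_prod_countable_right hf
  exact h.comp ((measurable_pieceIndex d).prodMk measurable_id)

theorem measurable_powerLaw (A α : ℝ) : Measurable (powerLaw A α) := by
  unfold powerLaw; fun_prop

theorem eventually_stacked_atTop {M : ℕ} (d : Fin M → ℝ) (f : Fin (M + 1) → ℝ → ℝ) :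
    ∀ᶠ r in atTop, stacked d f r = f (Fin.last M) r := by
  filter_upwards [eventually_all.2 fun i => eventually_gt_atTop (d i)] with r hr
  have : pieceIndex d r = Fin.last M := by
    simp [pieceIndex, Fin.ext_iff, Finset.filter_true_of_mem fun i _ => hr i]
  rw [stacked, this]

theorem eventually_stacked_nhdsGT_zero {M : ℕ} {d : Fin M → ℝ} (hd : ∀ i, 0 < d i)
    (f : Fin (M + 1) → ℝ → ℝ) : ∀ᶠ r in 𝓝[>] 0, stacked d f r = f 0 r := by
  have : ∀ᶠ r in 𝓝[>] (0 : ℝ), ∀ i, r < d i :=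
    eventually_all.2 fun i => nhdsWithin_le_nhds (Iio_mem_nhds (hd i))
  filter_upwards [this] with r hr
  have : pieceIndex d r = 0 := by
    simp [pieceIndex, Fin.ext_iff, Finset.filter_eq_empty_iff]
    exact fun i => (hr i).le
  rw [stacked, this]

/-- A gain function: strictly decreasing on `(0, ∞)`, from `∞` to `0`. -/
structure IsGain (g : ℝ → ℝ) : Prop where
  measurable : Measurable g
  strictAntiOn : StrictAntiOn g (Ioi 0)
  pos : ∀ r, 0 < r → 0 < g r
  tendsto_atTop : Tendsto g atTop (𝓝 0)
  tendsto_zero : Tendsto g (𝓝[>] 0) atTop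

theorem isGain_stacked {M : ℕ} {d : Fin M → ℝ} (hd : ∀ i, 0 < d i) {A α : Fin (M + 1) → ℝ}
    (hA : ∀ n, 0 < A n) (hα : ∀ n, 0 < α n)
    (hs : StrictAntiOn (stacked d fun n => powerLaw (A n) (α n)) (Ioi 0)) :
    IsGain (stacked d fun n => powerLaw (A n) (α n)) where
  measurable := measurable_stacked d fun n => measurable_powerLaw _ _
  strictAntiOn := hs
  pos r hr := mul_pos (hA _) (Real.rpow_pos_of_pos hr _)
  tendsto_atTop := by
    refine Tendsto.congr' ((eventually_stacked_atTop d _).mono fun r hr => hr.symm) ?_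
    have := (tendsto_rpow_neg_atTop (hα (Fin.last M))).const_mul (A (Fin.last M))
    rwa [mul_zero] at this
  tendsto_zero := by
    refine Tendsto.congr' ((eventually_stacked_nhdsGT_zero hd _).mono fun r hr => hr.symm) ?_
    exact (tendsto_rpow_neg_nhdsGT_zero (neg_lt_zero.2 (hα 0))).const_mul_atTop (hA 0)

namespace IsGain

variable {g : ℝ → ℝ} {c : ℝ}

theorem bddAbove (hg : IsGain g) (hc : 0 < c) : BddAbove {u | 0 < u ∧ c ≤ g u} := by
  obtain ⟨b, hb⟩ := (hg.tendsto_atTop.eventually (gt_mem_nhds hc)).exists_forall_of_atTop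
  exact ⟨b, fun u hu => le_of_not_gt fun hbu => (hb u hbu.le).not_ge hu.2⟩

theorem nonempty (hg : IsGain g) (c : ℝ) : {u | 0 < u ∧ c ≤ g u}.Nonempty := by
  obtain ⟨u, hu, hu0⟩ := ((hg.tendsto_zero.eventually (eventually_ge_atTop c)).and
    self_mem_nhdsWithin).exists
  exact ⟨u, hu0, hu⟩

theorem crossRadius_pos (hg : IsGain g) (hc : 0 < c) : 0 < crossRadius g c := by
  obtain ⟨u, hu⟩ := hg.nonempty c
  exact hu.1.trans_le (le_csSup (hg.bddAbove hc) hu)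

theorem le_crossRadius (hg : IsGain g) (hc : 0 < c) {u : ℝ} (hu : 0 < u) (h : c ≤ g u) :
    u ≤ crossRadius g c :=
  le_csSup (hg.bddAbove hc) ⟨hu, h⟩

theorem lt_of_lt_crossRadius (hg : IsGain g) {u : ℝ} (hu : 0 < u)
    (h : u < crossRadius g c) : c < g u := by
  obtain ⟨v, hv, huv⟩ := exists_lt_of_lt_csSup (hg.nonempty c) h
  exact hv.2.trans_lt (hg.strictAntiOn hu hv.1 huv)

theorem crossRadius_self (hg : IsGain g) {r : ℝ} (hr : 0 < r) : crossRadius g (g r) = r :=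
  crossRadius_eq hg.strictAntiOn hr rfl

end IsGain

namespace PathLossModel

variable (m : PathLossModel)

theorem isGain_gainL : IsGain m.gainL :=
  isGain_stacked m.d_pos m.AL_pos m.αL_pos m.gainL_strictAnti

theorem isGain_gainNL : IsGain m.gainNL :=
  isGain_stacked m.d_pos m.ANL_pos m.αNL_pos m.gainNL_strictAnti

/-- The LoS probability at `max r 0`. The pieces of `losProb` are unconstrained at negative
arguments, and this modification makes it measurable with values in `[0, 1]`. -/
noncomputable def losFun (r : ℝ) : ℝ := m.losProb (max r 0)

theorem losFun_eq {r : ℝ} (hr : 0 ≤ r) : m.losFun r = m.losProb r := by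
  rw [losFun, max_eq_left hr]

theorem losFun_nonneg (r : ℝ) : 0 ≤ m.losFun r := m.prL_nonneg _ _ (le_max_right _ _) rfl

theorem losFun_le_one (r : ℝ) : m.losFun r ≤ 1 := m.prL_le_one _ _ (le_max_right _ _) rfl

/-- Each piece of the LoS probability is monotone on its interval, hence measurable there. -/
theorem measurable_losFun : Measurable m.losFun := by
  have h (n : Fin (m.M + 1)) : ∃ g : ℝ → ℝ, Antitone g ∧
      EqOn (m.prL n) g {r | 0 ≤ r ∧ pieceIndex m.d r = n} := by
    refine (m.prL_antitone n).exists_antitone_extension ⟨0, ?_⟩ ⟨1, ?_⟩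
    · rintro _ ⟨r, hr, rfl⟩
      exact m.prL_nonneg n r hr.1 hr.2
    · rintro _ ⟨r, hr, rfl⟩
      exact m.prL_le_one n r hr.1 hr.2
  choose g hg hgeq using h
  have hm : Measurable fun r => stacked m.d g (max r 0) :=
    (measurable_stacked m.d fun n => (hg n).measurable).comp (measurable_id.max measurable_const)
  convert hm using 2 with r
  exact hgeq (pieceIndex m.d (max r 0)) ⟨le_max_right _ _, rfl⟩

end PathLossModel

theorem linkGain_eq_losFun (m : PathLossModel) (x y : Plane) (u : unitInterval) :
    linkGain m x y u =
      if (u : ℝ) < m.losFun (dist x y) then m.gainL (dist x y) else m.gainNL (dist x y) := by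
  rw [linkGain, m.losFun_eq dist_nonneg]

theorem measurable_linkGain (m : PathLossModel) :
    Measurable fun p : Plane × Plane × unitInterval => linkGain m p.1 p.2.1 p.2.2 := by
  simp_rw [linkGain_eq_losFun]
  have hd : Measurable fun p : Plane × Plane × unitInterval => dist p.1 p.2.1 := by fun_prop
  refine Measurable.ite (measurableSet_lt ?_ ?_) ?_ ?_
  · exact measurable_subtype_coe.comp (measurable_snd.comp measurable_snd)
  · exact m.measurable_losFun.comp hd
  · exact m.isGain_gainL.measurable.comp hd
  · exact m.isGain_gainNL.measurable.comp hd

theorem volume_unitInterval_lt {p : ℝ} (h0 : 0 ≤ p) (h1 : p ≤ 1) :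
    volume {u : unitInterval | (u : ℝ) < p} = ENNReal.ofReal p := by
  exact unitInterval.volume_Iio ⟨p, h0, h1⟩

/-! ### Tails of atomless measures -/

theorem continuous_measureReal_Ioi (ν : Measure ℝ) [IsFiniteMeasure ν] [NullSingletonClass ν] :
    Continuous fun s => ν.real (Ioi s) := by
  have h : Continuous fun s => ∫ _ in (0 : ℝ)..s, (1 : ℝ) ∂ν :=
    intervalIntegral.continuous_primitive
      (fun a b => ⟨integrableOn_const (measure_ne_top _ _),
        integrableOn_const (measure_ne_top _ _)⟩) 0
  have h2 : (fun s => ν.real (Ioi s)) =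
      fun s => ν.real (Ioi 0) - ∫ _ in (0 : ℝ)..s, (1 : ℝ) ∂ν := by
    ext s
    rw [intervalIntegral.integral_const', smul_eq_mul, mul_one]
    rcases le_total 0 s with hs | hs
    · have := measureReal_union (μ := ν) (s₁ := Ioc 0 s) (s₂ := Ioi s)
        (Set.disjoint_left.2 fun x hx hx' => not_lt.2 hx.2 hx') measurableSet_Ioi
      rw [Ioc_union_Ioi_eq_Ioi hs] at this
      rw [this, Ioc_eq_empty (not_lt.2 hs)]
      simp
    · have := measureReal_union (μ := ν) (s₁ := Ioc s 0) (s₂ := Ioi 0)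
        (Set.disjoint_left.2 fun x hx hx' => not_lt.2 hx.2 hx') measurableSet_Ioi
      rw [Ioc_union_Ioi_eq_Ioi hs] at this
      rw [this, Ioc_eq_empty (not_lt.2 hs)]
      simp [add_comm]
  rw [h2]
  exact continuous_const.sub h

theorem measureReal_Ioi_antitone (ν : Measure ℝ) [IsFiniteMeasure ν] :
    Antitone fun s => ν.real (Ioi s) := fun _ _ h => measureReal_mono (Ioi_subset_Ioi h)

theorem measureReal_setOf_measureReal_Ioi_le (ν : Measure ℝ) [IsFiniteMeasure ν]
    [NullSingletonClass ν]
    {t : ℝ} (h0 : 0 < t) (h1 : t < ν.real univ) : ν.real {s | ν.real (Ioi s) ≤ t} = t := by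
  have hcont := continuous_measureReal_Ioi ν
  have hbot : Tendsto (fun s => ν.real (Ioi s)) atBot (𝓝 (ν.real univ)) := by
    have := (ENNReal.tendsto_toReal (measure_ne_top ν univ)).comp (tendsto_measure_Ici_atBot ν)
    refine this.congr fun s => ?_
    exact congrArg ENNReal.toReal (measure_congr Ioi_ae_eq_Ici).symm
  have htop : Tendsto (fun s => ν.real (Ioi s)) atTop (𝓝 0) := by
    have := (ENNReal.tendsto_toReal (measure_ne_top ν univ)).comp (tendsto_measure_Iic_atTop ν)
    have h2 := this.const_sub (ν.real univ)
    rw [measureReal_def, sub_self] at h2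
    refine h2.congr fun s => ?_
    have := measureReal_compl (μ := ν) (measurableSet_Iic (a := s))
    rw [compl_Iic] at this
    rw [this]; rfl
  obtain ⟨a, ha⟩ := (hbot.eventually (lt_mem_nhds h1)).exists
  obtain ⟨b, hb⟩ := (htop.eventually (gt_mem_nhds h0)).exists
  obtain ⟨s₀, hs₀⟩ := mem_range_of_exists_le_of_exists_ge hcont ⟨b, hb.le⟩ ⟨a, ha.le⟩
  simp only at hs₀
  set S := {s | ν.real (Ioi s) ≤ t} with hS
  have hclosed : IsClosed S := isClosed_le hcont continuous_const
  have hbdd : BddBelow S := ⟨a, fun s hs => le_of_not_gt fun hsa =>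
    not_lt.2 (hs : ν.real (Ioi s) ≤ t) (ha.trans_le (measureReal_Ioi_antitone ν hsa.le))⟩
  have hne : S.Nonempty := ⟨s₀, hs₀.le⟩
  have hmem := hclosed.csInf_mem hne hbdd
  have hSeq : S = Ici (sInf S) := by
    ext s
    exact ⟨fun hs => csInf_le hbdd hs, fun hs => (measureReal_Ioi_antitone ν hs).trans hmem⟩
  have hval : ν.real (Ioi (sInf S)) = t :=
    le_antisymm hmem (hs₀ ▸ measureReal_Ioi_antitone ν (csInf_le hbdd hs₀.le))
  rw [hSeq, ← measureReal_congr Ioi_ae_eq_Ici, hval]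

/-- The tail function of an atomless measure pushes the measure forward to Lebesgue measure. -/
theorem map_measureReal_Ioi (ν : Measure ℝ) [IsFiniteMeasure ν] [NullSingletonClass ν] :
    ν.map (fun s => ν.real (Ioi s)) = volume.restrict (Ioc 0 (ν.real univ)) := by
  have hm : Measurable fun s => ν.real (Ioi s) := (continuous_measureReal_Ioi ν).measurable
  refine Measure.ext_of_Iic _ _ fun t => ?_
  rw [Measure.map_apply hm measurableSet_Iic, Measure.restrict_apply measurableSet_Iic,
    inter_comm, Ioc_inter_Iic, Real.volume_Ioc, sub_zero]
  change ν {s | ν.real (Ioi s) ≤ t} = _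
  rw [← ofReal_measureReal]
  rcases le_or_gt (ν.real univ) t with hT | hT
  · rw [min_eq_left hT]
    have : {s | ν.real (Ioi s) ≤ t} = univ :=
      eq_univ_of_forall fun s => (measureReal_mono (subset_univ _)).trans hT
    rw [this]
  rw [min_eq_right hT.le]
  rcases lt_trichotomy t 0 with h0 | h0 | h0
  · have : {s | ν.real (Ioi s) ≤ t} = ∅ :=
      eq_empty_of_forall_notMem fun s hs => not_lt.2 measureReal_nonneg ((hs : _ ≤ t).trans_lt h0)
    rw [this, measureReal_empty, ENNReal.ofReal_zero, ENNReal.ofReal_of_nonpos h0.le]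
  · subst h0
    congr 1
    refine le_antisymm (le_of_forall_pos_lt_add fun ε hε => ?_) measureReal_nonneg
    -- the value `t = 0` is not covered by the previous lemma, but bounded by small positive ones
    set δ := min (ε / 2) (ν.real univ / 2) with hδ
    have hδ0 : 0 < δ := lt_min (by positivity) (by positivity)
    have hle : ν.real {s | ν.real (Ioi s) ≤ 0} ≤ δ := by
      rw [← measureReal_setOf_measureReal_Ioi_le ν hδ0
        ((min_le_right _ _).trans_lt (half_lt_self hT))]
      exact measureReal_mono fun s hs => (hs : _ ≤ (0 : ℝ)).trans hδ0.le
    have : δ ≤ ε / 2 := min_le_left _ _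
    linarith
  · rw [measureReal_setOf_measureReal_Ioi_le ν h0 hT]

theorem lintegral_expNeg_measure_Ioi (ν : Measure ℝ) [IsFiniteMeasure ν] [NullSingletonClass ν] :
    ∫⁻ s, expNeg (ν (Ioi s)) ∂ν = 1 - expNeg (ν univ) := by
  have hm : Measurable fun s => ν.real (Ioi s) := (continuous_measureReal_Ioi ν).measurable
  have h1 (s : ℝ) : expNeg (ν (Ioi s)) = ENNReal.ofReal (Real.exp (-ν.real (Ioi s))) :=
    expNeg_eq_ofReal (measure_ne_top _ _)
  simp_rw [h1]
  rw [← lintegral_map (f := fun t => ENNReal.ofReal (Real.exp (-t))) (by fun_prop) hm,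
    map_measureReal_Ioi, ← ofReal_integral_eq_lintegral_ofReal _
      (ae_of_all _ fun t => (Real.exp_pos _).le),
    ← intervalIntegral.integral_of_le measureReal_nonneg, expNeg_eq_ofReal (measure_ne_top _ _),
    ← ENNReal.ofReal_one, ← ENNReal.ofReal_sub _ (Real.exp_pos _).le]
  · congr 1
    rw [intervalIntegral.integral_comp_neg (fun t => Real.exp t), integral_exp]
    simp [measureReal_def]
  · exact (Continuous.integrableOn_Ioc (by fun_prop))

/-- The substitution `t = ν (s, ∞)` in `∫ exp (-ν (s, ∞)) dν(s)`, for a measure without atoms. -/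
theorem setLIntegral_expNeg_measure_Ioi (ν : Measure ℝ) [NullSingletonClass ν]
    {c : ℝ} (hc : ν (Ioi c) ≠ ⊤) :
    ∫⁻ s in Ioi c, expNeg (ν (Ioi s)) ∂ν = 1 - expNeg (ν (Ioi c)) := by
  have : IsFiniteMeasure (ν.restrict (Ioi c)) := ⟨by simpa using hc.lt_top⟩
  have h := lintegral_expNeg_measure_Ioi (ν.restrict (Ioi c))
  rw [Measure.restrict_apply_univ] at h
  rw [← h]
  refine setLIntegral_congr_fun measurableSet_Ioi fun s hs => ?_
  simp only [Measure.restrict_apply measurableSet_Ioi]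
  rw [inter_eq_left.2 (Ioi_subset_Ioi (mem_Ioi.1 hs).le)]

/-! ### Polar coordinates -/

theorem map_norm_volume_plane : (volume : Measure Plane).map (fun x => ‖x‖) =
    (volume.restrict (Ioi 0)).withDensity fun r => ENNReal.ofReal (2 * Real.pi * r) := by
  refine Measure.ext_of_Ioc' _ _ (fun a b _ => ?_) fun a b hab => ?_
  · rw [Measure.map_apply measurable_norm measurableSet_Ioc]
    refine ne_top_of_le_ne_top (measure_closedBall_lt_top (x := (0 : Plane)) (r := b)).ne
      (measure_mono fun x hx => ?_)
    simpa using hx.2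
  · have hfin : volume ((fun x : Plane => ‖x‖) ⁻¹' Ioc a b) ≠ ⊤ := by
      refine ne_top_of_le_ne_top (measure_closedBall_lt_top (x := (0 : Plane)) (r := b)).ne
        (measure_mono fun x hx => ?_)
      simpa using hx.2
    have h := integral_fun_norm_addHaar (volume : Measure Plane) ((Ioc a b).indicator 1 : ℝ → ℝ)
    have h1 : ∫ x : Plane, (Ioc a b).indicator (1 : ℝ → ℝ) ‖x‖ =
        volume.real ((fun x : Plane => ‖x‖) ⁻¹' Ioc a b) := by
      rw [← integral_indicator_one (measurable_norm measurableSet_Ioc)]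
      rfl
    have hball : (volume : Measure Plane).real (Metric.ball 0 1) = Real.pi := by
      rw [measureReal_def, EuclideanSpace.volume_ball_fin_two]
      simp [Real.pi_pos.le]
    rw [h1, hball, finrank_euclideanSpace_fin] at h
    rw [Measure.map_apply measurable_norm measurableSet_Ioc, ← ofReal_measureReal hfin, h,
      withDensity_apply _ measurableSet_Ioc, Measure.restrict_restrict measurableSet_Ioc,
      ← ofReal_integral_eq_lintegral_ofReal]
    · congr 1
      have h2 : ∫ y in Ioi (0 : ℝ), y ^ (2 - 1) • (Ioc a b).indicator (1 : ℝ → ℝ) y =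
          ∫ y in Ioi (0 : ℝ) ∩ Ioc a b, y := by
        rw [← setIntegral_indicator measurableSet_Ioc]
        congr 1
        ext y
        by_cases hy : y ∈ Ioc a b
        · rw [indicator_of_mem hy, indicator_of_mem hy]; simp
        · rw [indicator_of_notMem hy, indicator_of_notMem hy, smul_zero]
      rw [h2, nsmul_eq_mul, smul_eq_mul, integral_const_mul, inter_comm, ← mul_assoc]
      norm_num
    · exact (Continuous.integrableOn_Ioc (by fun_prop)).mono_set inter_subset_left
    · refine (ae_restrict_iff' (measurableSet_Ioc.inter measurableSet_Ioi)).2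
        (ae_of_all _ fun r hr => ?_)
      have : (0 : ℝ) < r := hr.2
      positivity

theorem lintegral_fun_norm_plane {f : ℝ → ℝ≥0∞} (hf : Measurable f) :
    ∫⁻ x : Plane, f ‖x‖ = ∫⁻ r in Ioi 0, ENNReal.ofReal (2 * Real.pi * r) * f r := by
  rw [← lintegral_map hf measurable_norm, map_norm_volume_plane,
    lintegral_withDensity_eq_lintegral_mul _ (by fun_prop) hf]
  rfl

/-! ### The strongest gain -/

/-- The mean measure of the distances of the points of a Poisson process of intensity `lam`, where
a point at distance `u` is kept with probability `p u`. -/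
noncomputable def branchMeasure (p : ℝ → ℝ) (lam : ℝ) : Measure ℝ :=
  (volume.restrict (Ioi 0)).withDensity fun u => ENNReal.ofReal (p u * (2 * Real.pi * u * lam))

section Branch

variable {p : ℝ → ℝ} {lam : ℝ} {g : ℝ → ℝ} {c : ℝ}

theorem branchMeasure_absolutelyContinuous (p : ℝ → ℝ) (lam : ℝ) :
    branchMeasure p lam ≪ volume :=
  (withDensity_absolutelyContinuous _ _).trans Measure.absolutelyContinuous_restrict

instance (p : ℝ → ℝ) (lam : ℝ) : NullSingletonClass (branchMeasure p lam) where
  measure_singleton x := branchMeasure_absolutelyContinuous p lam (measure_singleton x)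

theorem ae_pos_branchMeasure (p : ℝ → ℝ) (lam : ℝ) : ∀ᵐ u ∂(branchMeasure p lam), 0 < u :=
  (withDensity_absolutelyContinuous _ _).ae_le (ae_restrict_mem measurableSet_Ioi)

theorem measurable_density (hp : Measurable p) :
    Measurable fun u => ENNReal.ofReal (p u * (2 * Real.pi * u * lam)) := by fun_prop

theorem IsGain.preimage_Ioi_ae_eq (hg : IsGain g) (hc : 0 < c) :
    g ⁻¹' Ioi c =ᵐ[branchMeasure p lam] Ioc 0 (crossRadius g c) := by
  have h : Ioo 0 (crossRadius g c) =ᵐ[branchMeasure p lam] Ioc 0 (crossRadius g c) :=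
    Ioo_ae_eq_Ioc
  filter_upwards [ae_pos_branchMeasure p lam, h] with u hu hu2
  refine propext ⟨fun hcu => ⟨hu, hg.le_crossRadius hc hu (le_of_lt hcu)⟩, fun huc => ?_⟩
  have h3 : u ∈ Ioo 0 (crossRadius g c) := hu2.mpr huc
  exact hg.lt_of_lt_crossRadius hu h3.2

theorem setLIntegral_branchMeasure (hp : Measurable p) {f : ℝ → ℝ≥0∞} (hf : Measurable f) (R : ℝ) :
    ∫⁻ u in Ioc 0 R, f u ∂(branchMeasure p lam) =
      ∫⁻ u in Ioc 0 R, ENNReal.ofReal (p u * (2 * Real.pi * u * lam)) * f u := by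
  rw [branchMeasure, restrict_withDensity measurableSet_Ioc,
    lintegral_withDensity_eq_lintegral_mul _ (measurable_density hp) hf,
    Measure.restrict_restrict measurableSet_Ioc, inter_eq_left.2 Ioc_subset_Ioi_self]
  rfl

theorem setLIntegral_map_branchMeasure (hg : IsGain g) (hc : 0 < c) (hp : Measurable p)
    {f : ℝ → ℝ≥0∞} (hf : Measurable f) :
    ∫⁻ s in Ioi c, f s ∂((branchMeasure p lam).map g) =
      ∫⁻ u in Ioc 0 (crossRadius g c),
        ENNReal.ofReal (p u * (2 * Real.pi * u * lam)) * f (g u) := by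
  rw [setLIntegral_map measurableSet_Ioi hf hg.measurable,
    setLIntegral_congr (hg.preimage_Ioi_ae_eq hc),
    setLIntegral_branchMeasure (f := fun u => f (g u)) hp (hf.comp hg.measurable)]

theorem lintegral_density_Ioc (hp : Measurable p) (h0 : ∀ u, 0 ≤ p u) (h1 : ∀ u, p u ≤ 1)
    (hlam : 0 ≤ lam) {R : ℝ} (hR : 0 ≤ R) :
    ∫⁻ u in Ioc 0 R, ENNReal.ofReal (p u * (2 * Real.pi * u * lam)) =
      ENNReal.ofReal (∫ u in (0 : ℝ)..R, p u * (2 * Real.pi * u * lam)) := by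
  rw [intervalIntegral.integral_of_le hR, ofReal_integral_eq_lintegral_ofReal]
  · have hi : IntegrableOn (fun u => 2 * Real.pi * u * lam) (Ioc 0 R) :=
      Continuous.integrableOn_Ioc (by fun_prop)
    refine hi.mono' (by fun_prop)
      ((ae_restrict_iff' measurableSet_Ioc).2 (ae_of_all _ fun u hu => ?_))
    have := h0 u
    have := hu.1
    have hd : 0 ≤ 2 * Real.pi * u * lam := by positivity
    rw [Real.norm_of_nonneg (by positivity)]
    exact mul_le_of_le_one_left hd (h1 u)
  · refine (ae_restrict_iff' measurableSet_Ioc).2 (ae_of_all _ fun u hu => ?_)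
    have := h0 u
    have := hu.1
    positivity

theorem map_branchMeasure_Ioi (hg : IsGain g) (hc : 0 < c) (hp : Measurable p)
    (h0 : ∀ u, 0 ≤ p u) (h1 : ∀ u, p u ≤ 1) (hlam : 0 ≤ lam) :
    (branchMeasure p lam).map g (Ioi c) =
      ENNReal.ofReal (∫ u in (0 : ℝ)..crossRadius g c, p u * (2 * Real.pi * u * lam)) := by
  have h := setLIntegral_map_branchMeasure (lam := lam) hg hc hp measurable_one
  simp only [Pi.one_apply, mul_one, setLIntegral_one] at h
  rw [h, lintegral_density_Ioc hp h0 h1 hlam (hg.crossRadius_pos hc).le]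

theorem IsGain.map_branchMeasure_singleton (hg : IsGain g) (s : ℝ) :
    (branchMeasure p lam).map g {s} = 0 := by
  rw [Measure.map_apply hg.measurable (measurableSet_singleton s)]
  have h : (g ⁻¹' {s} ∩ Ioi 0).Subsingleton := by
    rintro a ⟨ha, ha0⟩ b ⟨hb, hb0⟩
    exact hg.strictAntiOn.injOn ha0 hb0
      ((mem_singleton_iff.1 ha).trans (mem_singleton_iff.1 hb).symm)
  refine measure_mono_null_ae ?_ (h.measure_zero (branchMeasure p lam))
  filter_upwards [ae_pos_branchMeasure p lam] with u hu hus
  exact ⟨hus, hu⟩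

end Branch

namespace PathLossModel

variable (m : PathLossModel) {lam : ℝ}

/-- The mean measure of the gains seen by a UE when the BSs have intensity `lam`: the sum of the
images of the LoS and of the NLoS distances. -/
noncomputable def axisMeasure (lam : ℝ) : Measure ℝ :=
  (branchMeasure m.losFun lam).map m.gainL +
    (branchMeasure (fun u => 1 - m.losFun u) lam).map m.gainNL

instance (lam : ℝ) : NullSingletonClass (m.axisMeasure lam) where
  measure_singleton s := by
    rw [axisMeasure, Measure.add_apply, m.isGain_gainL.map_branchMeasure_singleton,
      m.isGain_gainNL.map_branchMeasure_singleton, add_zero]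

theorem measurable_one_sub_losFun : Measurable fun u => 1 - m.losFun u :=
  m.measurable_losFun.const_sub 1

theorem integral_losProb_eq {R : ℝ} (hR : 0 ≤ R) (lam : ℝ) :
    ∫ u in (0 : ℝ)..R, m.losProb u * (2 * Real.pi * u * lam) =
      ∫ u in (0 : ℝ)..R, m.losFun u * (2 * Real.pi * u * lam) := by
  refine intervalIntegral.integral_congr fun u hu => ?_
  rw [uIcc_of_le hR] at hu
  simp only [m.losFun_eq hu.1]

theorem integral_one_sub_losProb_eq {R : ℝ} (hR : 0 ≤ R) (lam : ℝ) :
    ∫ u in (0 : ℝ)..R, (1 - m.losProb u) * (2 * Real.pi * u * lam) =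
      ∫ u in (0 : ℝ)..R, (1 - m.losFun u) * (2 * Real.pi * u * lam) := by
  refine intervalIntegral.integral_congr fun u hu => ?_
  rw [uIcc_of_le hR] at hu
  simp only [m.losFun_eq hu.1]

theorem axisMeasure_Ioi (hlam : 0 ≤ lam) {c : ℝ} (hc : 0 < c) :
    m.axisMeasure lam (Ioi c) =
      ENNReal.ofReal (∫ u in (0 : ℝ)..crossRadius m.gainL c,
        m.losProb u * (2 * Real.pi * u * lam)) +
      ENNReal.ofReal (∫ u in (0 : ℝ)..crossRadius m.gainNL c,
        (1 - m.losProb u) * (2 * Real.pi * u * lam)) := by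
  rw [axisMeasure, Measure.add_apply,
    map_branchMeasure_Ioi m.isGain_gainL hc m.measurable_losFun m.losFun_nonneg m.losFun_le_one
      hlam,
    map_branchMeasure_Ioi m.isGain_gainNL hc m.measurable_one_sub_losFun
      (fun u => sub_nonneg.2 (m.losFun_le_one u)) (fun u => sub_le_self _ (m.losFun_nonneg u)) hlam,
    m.integral_losProb_eq (m.isGain_gainL.crossRadius_pos hc).le,
    m.integral_one_sub_losProb_eq (m.isGain_gainNL.crossRadius_pos hc).le]

theorem axisMeasure_Ioi_ne_top (hlam : 0 ≤ lam) {c : ℝ} (hc : 0 < c) :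
    m.axisMeasure lam (Ioi c) ≠ ⊤ := by
  rw [m.axisMeasure_Ioi hlam hc]
  exact ENNReal.add_ne_top.2 ⟨ENNReal.ofReal_ne_top, ENNReal.ofReal_ne_top⟩

/-- The probability that no BS has a gain above `c`, in terms of the two crossing radii. -/
theorem expNeg_axisMeasure_Ioi (hlam : 0 ≤ lam) {c : ℝ} (hc : 0 < c) :
    expNeg (m.axisMeasure lam (Ioi c)) =
      ENNReal.ofReal (Real.exp (-∫ u in (0 : ℝ)..crossRadius m.gainNL c,
        (1 - m.losProb u) * (2 * Real.pi * u * lam)) *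
      Real.exp (-∫ u in (0 : ℝ)..crossRadius m.gainL c,
        m.losProb u * (2 * Real.pi * u * lam))) := by
  have h1 := (m.isGain_gainL.crossRadius_pos hc).le
  have h2 := (m.isGain_gainNL.crossRadius_pos hc).le
  rw [m.axisMeasure_Ioi hlam hc, expNeg_add, expNeg_ofReal, expNeg_ofReal,
    ← ENNReal.ofReal_mul (Real.exp_pos _).le, mul_comm]
  · rw [m.integral_one_sub_losProb_eq h2]
    refine intervalIntegral.integral_nonneg h2 fun u hu => ?_
    have := sub_nonneg.2 (m.losFun_le_one u)
    have := hu.1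
    positivity
  · rw [m.integral_losProb_eq h1]
    refine intervalIntegral.integral_nonneg h1 fun u hu => ?_
    have := m.losFun_nonneg u
    have := hu.1
    positivity

theorem measurable_expNeg_axisMeasure_Ioi (lam : ℝ) :
    Measurable fun s => expNeg (m.axisMeasure lam (Ioi s)) :=
  measurable_expNeg.comp
    (Antitone.measurable fun _ _ h => measure_mono (Ioi_subset_Ioi h))

theorem ofReal_fL (hlam : 0 ≤ lam) {u : ℝ} (hu : 0 < u) :
    ENNReal.ofReal (m.fL lam u) = ENNReal.ofReal (m.losFun u * (2 * Real.pi * u * lam)) *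
      expNeg (m.axisMeasure lam (Ioi (m.gainL u))) := by
  rw [m.expNeg_axisMeasure_Ioi hlam (m.isGain_gainL.pos u hu), m.isGain_gainL.crossRadius_self hu,
    m.losFun_eq hu.le, mul_comm, ← ENNReal.ofReal_mul (by positivity)]
  rfl

theorem ofReal_fNL (hlam : 0 ≤ lam) {u : ℝ} (hu : 0 < u) :
    ENNReal.ofReal (m.fNL lam u) = ENNReal.ofReal ((1 - m.losFun u) * (2 * Real.pi * u * lam)) *
      expNeg (m.axisMeasure lam (Ioi (m.gainNL u))) := by
  rw [m.expNeg_axisMeasure_Ioi hlam (m.isGain_gainNL.pos u hu), m.isGain_gainNL.crossRadius_self hu,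
    m.losFun_eq hu.le, mul_comm, ← ENNReal.ofReal_mul (by positivity),
    mul_comm (Real.exp _) (Real.exp _)]
  rfl

theorem fL_nonneg (hlam : 0 ≤ lam) {u : ℝ} (hu : 0 < u) : 0 ≤ m.fL lam u := by
  have := m.losFun_nonneg u
  rw [m.losFun_eq hu.le] at this
  unfold fL; positivity

theorem fNL_nonneg (hlam : 0 ≤ lam) {u : ℝ} (hu : 0 < u) : 0 ≤ m.fNL lam u := by
  have := sub_nonneg.2 (m.losFun_le_one u)
  rw [m.losFun_eq hu.le] at this
  unfold fNL; positivity

/-- Only positive arguments matter, so that `f` need not be measurable. -/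
theorem _root_.intervalIntegral_eq_toReal_lintegral {f : ℝ → ℝ} {F : ℝ → ℝ≥0∞} (hF : Measurable F)
    (hf : ∀ u, 0 < u → 0 ≤ f u) (hfF : ∀ u, 0 < u → ENNReal.ofReal (f u) = F u)
    {R : ℝ} (hR : 0 ≤ R) : ∫ u in (0 : ℝ)..R, f u = (∫⁻ u in Ioc 0 R, F u).toReal := by
  have h1 : ∫ u in Ioc 0 R, f u = ∫ u in Ioc 0 R, (F u).toReal := by
    refine setIntegral_congr_fun measurableSet_Ioc fun u hu => ?_
    rw [← hfF u hu.1, ENNReal.toReal_ofReal (hf u hu.1)]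
  rw [intervalIntegral.integral_of_le hR, h1, integral_toReal hF.aemeasurable]
  refine (ae_restrict_iff' measurableSet_Ioc).2 (ae_of_all _ fun u hu => ?_)
  rw [← hfF u hu.1]
  exact ENNReal.ofReal_lt_top

/-- `F_R^L` and `F_R^NL` add up to the probability that the strongest gain exceeds a level. -/
theorem FL_add_FNL (hlam : 0 ≤ lam) {c : ℝ} (hc : 0 < c) :
    m.FL lam (crossRadius m.gainL c) + m.FNL lam (crossRadius m.gainNL c) =
      1 - (expNeg (m.axisMeasure lam (Ioi c))).toReal := by
  have hm := m.measurable_expNeg_axisMeasure_Ioi lam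
  have h := setLIntegral_expNeg_measure_Ioi (m.axisMeasure lam) (m.axisMeasure_Ioi_ne_top hlam hc)
  have h' : ∫⁻ s in Ioi c, expNeg (m.axisMeasure lam (Ioi s)) ∂(m.axisMeasure lam) =
      (∫⁻ s in Ioi c, expNeg (m.axisMeasure lam (Ioi s))
        ∂((branchMeasure m.losFun lam).map m.gainL)) +
      ∫⁻ s in Ioi c, expNeg (m.axisMeasure lam (Ioi s))
        ∂((branchMeasure (fun u => 1 - m.losFun u) lam).map m.gainNL) := by
    conv_lhs => enter [1]; rw [axisMeasure]
    rw [Measure.restrict_add, lintegral_add_measure]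
  rw [h', setLIntegral_map_branchMeasure m.isGain_gainL hc m.measurable_losFun hm,
    setLIntegral_map_branchMeasure m.isGain_gainNL hc m.measurable_one_sub_losFun hm] at h
  have hfin : (1 : ℝ≥0∞) - expNeg (m.axisMeasure lam (Ioi c)) ≠ ⊤ :=
    ne_top_of_le_ne_top ENNReal.one_ne_top tsub_le_self
  rw [← h] at hfin
  rw [FL, FNL, intervalIntegral_eq_toReal_lintegral
      ((measurable_density m.measurable_losFun).mul (hm.comp m.isGain_gainL.measurable))
      (fun u hu => m.fL_nonneg hlam hu) (fun u hu => m.ofReal_fL hlam hu)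
      (m.isGain_gainL.crossRadius_pos hc).le,
    intervalIntegral_eq_toReal_lintegral
      ((measurable_density m.measurable_one_sub_losFun).mul (hm.comp m.isGain_gainNL.measurable))
      (fun u hu => m.fNL_nonneg hlam hu) (fun u hu => m.ofReal_fNL hlam hu)
      (m.isGain_gainNL.crossRadius_pos hc).le]
  refine (ENNReal.toReal_add (ENNReal.add_ne_top.1 hfin).1
    (ENNReal.add_ne_top.1 hfin).2).symm.trans ((congrArg ENNReal.toReal h).trans ?_)
  rw [ENNReal.toReal_sub_of_le (expNeg_le_one _) ENNReal.one_ne_top, ENNReal.toReal_one]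

/-- The probability that a UE at distance `r` from the tagged BS is associated with it: the average
over the LoS and NLoS states of its link. -/
noncomputable def assocProb (lam r : ℝ) : ℝ≥0∞ :=
  ENNReal.ofReal (m.losFun r) * expNeg (m.axisMeasure lam (Ioi (m.gainL r))) +
    ENNReal.ofReal (1 - m.losFun r) * expNeg (m.axisMeasure lam (Ioi (m.gainNL r)))

theorem measurable_assocProb (lam : ℝ) : Measurable (m.assocProb lam) := by
  have hm := m.measurable_expNeg_axisMeasure_Ioi lam
  exact ((m.measurable_losFun.ennreal_ofReal).mul (hm.comp m.isGain_gainL.measurable)).add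
    ((m.measurable_one_sub_losFun.ennreal_ofReal).mul (hm.comp m.isGain_gainNL.measurable))

theorem assocProb_le_one (lam r : ℝ) : m.assocProb lam r ≤ 1 := by
  calc m.assocProb lam r
      ≤ ENNReal.ofReal (m.losFun r) * 1 + ENNReal.ofReal (1 - m.losFun r) * 1 := by
        unfold assocProb
        gcongr <;> exact expNeg_le_one _
    _ = 1 := by
        rw [mul_one, mul_one, ← ENNReal.ofReal_add (m.losFun_nonneg r)
          (sub_nonneg.2 (m.losFun_le_one r))]
        simp

theorem notAssocGiven_eq (hlam : 0 ≤ lam) {r : ℝ} (hr : 0 < r) :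
    m.notAssocGiven lam r = (1 - m.assocProb lam r).toReal := by
  have h1 := m.FL_add_FNL hlam (m.isGain_gainL.pos r hr)
  have h2 := m.FL_add_FNL hlam (m.isGain_gainNL.pos r hr)
  rw [m.isGain_gainL.crossRadius_self hr] at h1
  rw [m.isGain_gainNL.crossRadius_self hr] at h2
  rw [notAssocGiven, r1, r2, h1, h2, ENNReal.toReal_sub_of_le (m.assocProb_le_one _ _)
    ENNReal.one_ne_top, assocProb, ENNReal.toReal_add
      (ENNReal.mul_ne_top ENNReal.ofReal_ne_top (expNeg_ne_top _))
      (ENNReal.mul_ne_top ENNReal.ofReal_ne_top (expNeg_ne_top _)), ENNReal.toReal_mul,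
    ENNReal.toReal_mul, ENNReal.toReal_ofReal (m.losFun_nonneg r),
    ENNReal.toReal_ofReal (sub_nonneg.2 (m.losFun_le_one r)), m.losFun_eq hr.le, ENNReal.toReal_one]
  ring

end PathLossModel

/-! ### The tagged UE -/

/-- The probability that a link from `z` to `y` has gain at most `c`. -/
noncomputable def linkBelow (m : PathLossModel) (c : ℝ) (z y : Plane) : ℝ≥0∞ :=
  volume {v : unitInterval | linkGain m z y v ≤ c}

theorem linkBelow_le_one (m : PathLossModel) (c : ℝ) (z y : Plane) : linkBelow m c z y ≤ 1 :=
  prob_le_one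

theorem measurableSet_linkGain_le (m : PathLossModel) :
    MeasurableSet {p : (ℝ × Plane × Plane) × unitInterval |
      linkGain m p.1.2.1 p.1.2.2 p.2 ≤ p.1.1} := by
  refine measurableSet_le ?_ (by fun_prop)
  exact (measurable_linkGain m).comp
    (by fun_prop : Measurable fun p : (ℝ × Plane × Plane) × unitInterval =>
      (p.1.2.1, p.1.2.2, p.2))

theorem measurable_linkBelow (m : PathLossModel) :
    Measurable fun p : ℝ × Plane × Plane => linkBelow m p.1 p.2.1 p.2.2 :=
  measurable_measure_prodMk_left (measurableSet_linkGain_le m)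

theorem Measurable.linkBelow {α : Type*} [MeasurableSpace α] (m : PathLossModel)
    {c : α → ℝ} {z y : α → Plane} (hc : Measurable c) (hz : Measurable z) (hy : Measurable y) :
    Measurable fun a => linkBelow m (c a) (z a) (y a) := by
  have h := (measurable_linkBelow m).comp (hc.prodMk (hz.prodMk hy))
  unfold Function.comp at h
  exact h

theorem Measurable.negLog {α : Type*} [MeasurableSpace α] {f : α → ℝ≥0∞}
    (hf : Measurable f) : Measurable fun a => negLog (f a) :=
  measurable_negLog.comp hf

theorem Measurable.expNeg {α : Type*} [MeasurableSpace α] {f : α → ℝ≥0∞}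
    (hf : Measurable f) : Measurable fun a => expNeg (f a) :=
  measurable_expNeg.comp hf

theorem Measurable.linkGain {α : Type*} [MeasurableSpace α] (m : PathLossModel)
    {z y : α → Plane} {u : α → unitInterval} (hz : Measurable z) (hy : Measurable y)
    (hu : Measurable u) : Measurable fun a => linkGain m (z a) (y a) (u a) :=
  (measurable_linkGain m).comp (hz.prodMk (hy.prodMk hu))

theorem one_sub_linkBelow (m : PathLossModel) (c : ℝ) (z y : Plane) :
    1 - linkBelow m c z y = volume {v : unitInterval | c < linkGain m z y v} := by
  have hm : MeasurableSet {v : unitInterval | linkGain m z y v ≤ c} :=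
    measurable_prodMk_left (x := ((c, z, y) : ℝ × Plane × Plane)) (measurableSet_linkGain_le m)
  have := prob_compl_eq_one_sub (μ := (volume : Measure unitInterval)) hm
  rw [linkBelow, ← this]
  congr 1
  ext v
  simp

theorem lintegral_linkGain (m : PathLossModel) (x y : Plane) {f : ℝ → ℝ≥0∞} :
    ∫⁻ u : unitInterval, f (linkGain m x y u) =
      ENNReal.ofReal (m.losFun (dist x y)) * f (m.gainL (dist x y)) +
        ENNReal.ofReal (1 - m.losFun (dist x y)) * f (m.gainNL (dist x y)) := by
  set d := dist x y
  have hS : MeasurableSet {u : unitInterval | (u : ℝ) < m.losFun d} :=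
    measurableSet_lt measurable_subtype_coe measurable_const
  have hv := volume_unitInterval_lt (m.losFun_nonneg d) (m.losFun_le_one d)
  have hvc : volume {u : unitInterval | (u : ℝ) < m.losFun d}ᶜ =
      ENNReal.ofReal (1 - m.losFun d) := by
    rw [prob_compl_eq_one_sub hS, hv, ENNReal.ofReal_sub _ (m.losFun_nonneg d), ENNReal.ofReal_one]
  rw [← lintegral_add_compl _ hS]
  congr 1
  · rw [setLIntegral_congr_fun (g := fun _ => f (m.gainL d)) hS, setLIntegral_const, hv, mul_comm]
    intro u hu
    have hu' : (u : ℝ) < m.losFun d := hu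
    simp only [linkGain_eq_losFun]
    rw [if_pos hu']
  · rw [setLIntegral_congr_fun (g := fun _ => f (m.gainNL d)) hS.compl, setLIntegral_const, hvc,
      mul_comm]
    intro u hu
    have hu' : ¬ (u : ℝ) < m.losFun d := hu
    simp only [linkGain_eq_losFun]
    rw [if_neg hu']

theorem one_sub_linkBelow_eq (m : PathLossModel) (c : ℝ) (z y : Plane) :
    1 - linkBelow m c z y =
      ENNReal.ofReal (m.losFun (dist z y)) * (Ioi c).indicator 1 (m.gainL (dist z y)) +
        ENNReal.ofReal (1 - m.losFun (dist z y)) * (Ioi c).indicator 1 (m.gainNL (dist z y)) := by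
  have hm : MeasurableSet {v : unitInterval | c < linkGain m z y v} :=
    measurableSet_lt measurable_const
      ((measurable_linkGain m).comp (by fun_prop : Measurable fun v : unitInterval => (z, y, v)))
  rw [one_sub_linkBelow, ← lintegral_linkGain m z y, ← lintegral_indicator_one hm]
  rfl

theorem map_branchMeasure_Ioi_eq_lintegral {p g : ℝ → ℝ} (hp : Measurable p) (hg : Measurable g)
    (lam c : ℝ) : (branchMeasure p lam).map g (Ioi c) =
      ∫⁻ u in Ioi 0, ENNReal.ofReal (p u * (2 * Real.pi * u * lam)) *
        (Ioi c).indicator 1 (g u) := by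
  have hi : Measurable ((Ioi c).indicator (1 : ℝ → ℝ≥0∞)) :=
    measurable_one.indicator measurableSet_Ioi
  have hig : Measurable fun u => (Ioi c).indicator (1 : ℝ → ℝ≥0∞) (g u) := hi.comp hg
  rw [← lintegral_indicator_one measurableSet_Ioi, lintegral_map hi hg, branchMeasure,
    lintegral_withDensity_eq_lintegral_mul _ (measurable_density hp) hig]
  rfl

/-- The expected number of BSs whose gain to `y` exceeds `c`, computed in the plane and on the gain
axis. -/
theorem mul_lintegral_one_sub_linkBelow (m : PathLossModel) {lam : ℝ} (hlam : 0 ≤ lam) (c : ℝ)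
    (y : Plane) : ENNReal.ofReal lam * ∫⁻ z, (1 - linkBelow m c z y) =
      m.axisMeasure lam (Ioi c) := by
  have hi : Measurable ((Ioi c).indicator (1 : ℝ → ℝ≥0∞)) :=
    measurable_one.indicator measurableSet_Ioi
  let φ : ℝ → ℝ≥0∞ := fun r =>
    ENNReal.ofReal (m.losFun r) * (Ioi c).indicator 1 (m.gainL r) +
      ENNReal.ofReal (1 - m.losFun r) * (Ioi c).indicator 1 (m.gainNL r)
  have hφ1 : Measurable fun r => ENNReal.ofReal (m.losFun r) * (Ioi c).indicator 1 (m.gainL r) :=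
    m.measurable_losFun.ennreal_ofReal.mul (hi.comp m.isGain_gainL.measurable)
  have hφ2 : Measurable fun r =>
      ENNReal.ofReal (1 - m.losFun r) * (Ioi c).indicator 1 (m.gainNL r) :=
    m.measurable_one_sub_losFun.ennreal_ofReal.mul (hi.comp m.isGain_gainNL.measurable)
  have hφ : Measurable φ := hφ1.add hφ2
  have hL : Measurable fun u => ENNReal.ofReal (m.losFun u * (2 * Real.pi * u * lam)) *
      (Ioi c).indicator 1 (m.gainL u) :=
    (measurable_density m.measurable_losFun).mul (hi.comp m.isGain_gainL.measurable)
  have h1 : ∫⁻ z, (1 - linkBelow m c z y) = ∫⁻ z : Plane, φ ‖z‖ := by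
    simp_rw [one_sub_linkBelow_eq, dist_eq_norm]
    exact lintegral_sub_right_eq_self (fun z : Plane => φ ‖z‖) y
  rw [h1, lintegral_fun_norm_plane hφ, PathLossModel.axisMeasure, Measure.add_apply,
    map_branchMeasure_Ioi_eq_lintegral m.measurable_losFun m.isGain_gainL.measurable,
    map_branchMeasure_Ioi_eq_lintegral m.measurable_one_sub_losFun m.isGain_gainNL.measurable,
    ← lintegral_add_left hL, ← lintegral_const_mul' _ _ ENNReal.ofReal_ne_top]
  refine setLIntegral_congr_fun measurableSet_Ioi fun u hu => ?_
  have hu0 : (0 : ℝ) < u := hu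
  have key (q : ℝ) : ENNReal.ofReal (q * (2 * Real.pi * u * lam)) =
      ENNReal.ofReal lam * (ENNReal.ofReal (2 * Real.pi * u) * ENNReal.ofReal q) := by
    rw [← ENNReal.ofReal_mul (by positivity), ← ENNReal.ofReal_mul hlam]
    congr 1; ring
  simp only [φ, key]
  ring

/-- The conditional probability that a UE at `y` is associated with a BS at `x`, given that the
other BSs are the atoms of `μ`: the mark `u` of the link to `x` is integrated out, and the other
links have gain at most the one of that link. -/
noncomputable def assocGiven (m : PathLossModel) (x y : Plane) (μ : Measure Plane) : ℝ≥0∞ :=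
  ∫⁻ u : unitInterval, expNeg (∫⁻ z, negLog (linkBelow m (linkGain m x y u) z y) ∂μ)

theorem measurable_negLog_linkBelow (m : PathLossModel) (c : ℝ) (y : Plane) :
    Measurable fun z => negLog (linkBelow m c z y) :=
  (Measurable.linkBelow m measurable_const measurable_id measurable_const).negLog

theorem assocGiven_le_one (m : PathLossModel) (x y : Plane) (μ : Measure Plane) :
    assocGiven m x y μ ≤ 1 := by
  calc assocGiven m x y μ ≤ ∫⁻ _ : unitInterval, 1 := lintegral_mono fun u => expNeg_le_one _
    _ = 1 := by simp

theorem assocGiven_pointMeasure (m : PathLossModel) (x y : Plane) {ι : Type*} (b : ι → Plane) :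
    assocGiven m x y (pointMeasure b) =
      ∫⁻ u : unitInterval, expNeg (∑' k, negLog (linkBelow m (linkGain m x y u) (b k) y)) := by
  refine lintegral_congr fun u => ?_
  rw [lintegral_pointMeasure _ (measurable_negLog_linkBelow m _ y)]

/-- Given the positions, the link marks of UE `y` decide the association. -/
theorem infinitePi_forall_linkGain_le (m : PathLossModel) {ι : Type*} [Countable ι] (i : ι)
    (b : ι → Plane) (y : Plane) :
    (Measure.infinitePi fun _ : ι => (volume : Measure unitInterval))
      {v | ∀ k, linkGain m (b k) y (v k) ≤ linkGain m (b i) y (v i)} =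
      assocGiven m (b i) y (pointMeasure fun k : {k // k ≠ i} => b k) := by
  have hT (k : ι) : MeasurableSet {p : unitInterval × unitInterval |
      linkGain m (b k) y p.2 ≤ linkGain m (b i) y p.1} :=
    measurableSet_le
      ((measurable_linkGain m).comp
        (by fun_prop : Measurable fun p : unitInterval × unitInterval => (b k, y, p.2)))
      ((measurable_linkGain m).comp
        (by fun_prop : Measurable fun p : unitInterval × unitInterval => (b i, y, p.1)))
  have h := infinitePi_forall_of_coord (volume : Measure unitInterval) i hT
  rw [assocGiven_pointMeasure]
  refine Eq.trans ?_ h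
  congr 1
  ext v
  refine ⟨fun hv k _ => hv k, fun hv k => ?_⟩
  by_cases hk : k = i
  · rw [hk]
  · exact hv k hk

theorem pointMeasure_comp_equiv {ι κ : Type*} (e : κ ≃ ι) (b : ι → Plane) :
    pointMeasure (fun k => b (e k)) = pointMeasure b := by
  ext B hB
  simp only [pointMeasure, Measure.sum_apply _ hB]
  exact e.tsum_eq fun k => Measure.dirac (b k) B

namespace IsHPPP

variable {Ω : Type*} [MeasurableSpace Ω] {P : Measure Ω}
  {X : ℕ → Ω → Plane} {lam : ℝ}

/-- Averaging the conditional association probability over the BSs, by the Laplace functional. -/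
theorem lintegral_assocGiven [IsProbabilityMeasure P] (h : IsHPPP P X lam)
    (hlam : 0 ≤ lam) (m : PathLossModel) (x y : Plane) :
    ∫⁻ ω, assocGiven m x y (pointMeasure fun i => X i ω) ∂P =
      m.assocProb lam (dist x y) := by
  simp_rw [assocGiven_pointMeasure]
  rw [lintegral_lintegral_swap]
  · have h1 (u : unitInterval) :
        ∫⁻ ω, expNeg (∑' k, negLog (linkBelow m (linkGain m x y u) (X k ω) y)) ∂P =
          expNeg (m.axisMeasure lam (Ioi (linkGain m x y u))) := by
      have hm := measurable_negLog_linkBelow m (linkGain m x y u) y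
      have h2 := h.lintegral_expNeg hlam hm
      simp_rw [lintegral_pointMeasure _ hm] at h2
      rw [h2, ← mul_lintegral_one_sub_linkBelow m hlam _ y]
      simp_rw [expNeg_negLog (linkBelow_le_one m _ _ _)]
    simp_rw [h1]
    exact lintegral_linkGain m x y (f := fun c => expNeg (m.axisMeasure lam (Ioi c)))
  · refine (Measurable.expNeg (Measurable.tsum fun k => ?_)).aemeasurable
    exact (Measurable.linkBelow m (.linkGain m measurable_const measurable_const measurable_snd)
      ((h.measurable k).comp measurable_fst) measurable_const).negLog

theorem measurableSet_taggedNotAssoc (h : IsHPPP P X lam) (m : PathLossModel) :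
    MeasurableSet {p : Ω × Plane × (Option ℕ → unitInterval) |
      TaggedNotAssoc m (fun i => X i p.1) p.2.1 p.2.2} := by
  have : {p : Ω × Plane × (Option ℕ → unitInterval) |
      TaggedNotAssoc m (fun i => X i p.1) p.2.1 p.2.2} = ⋃ i : ℕ,
      {p | linkGain m 0 p.2.1 (p.2.2 none) < linkGain m (X i p.1) p.2.1 (p.2.2 (some i))} := by
    ext p; simp [TaggedNotAssoc]
  rw [this]
  refine MeasurableSet.iUnion fun i => ?_
  have hX := h.measurable i
  exact measurableSet_lt
    ((measurable_linkGain m).comp (by fun_prop :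
      Measurable fun p : Ω × Plane × (Option ℕ → unitInterval) => ((0 : Plane), p.2.1, p.2.2 none)))
    ((measurable_linkGain m).comp (by fun_prop :
      Measurable fun p : Ω × Plane × (Option ℕ → unitInterval) => (X i p.1, p.2.1, p.2.2 (some i))))

theorem markLaw_taggedNotAssoc (h : IsHPPP P X lam) (m : PathLossModel) (w : Plane) (ω : Ω) :
    markLaw {v | TaggedNotAssoc m (fun i => X i ω) w v} =
      1 - assocGiven m 0 w (pointMeasure fun i => X i ω) := by
  have hmS : MeasurableSet {v | TaggedNotAssoc m (fun i => X i ω) w v} :=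
    (measurable_prodMk_left.comp measurable_prodMk_left :
      Measurable fun v : Option ℕ → unitInterval => (ω, w, v)) (h.measurableSet_taggedNotAssoc m)
  have h1 := infinitePi_forall_linkGain_le m (none : Option ℕ)
    (fun k => k.elim (0 : Plane) fun i => X i ω) w
  let e : ℕ ≃ {k : Option ℕ // k ≠ none} := Equiv.ofBijective (fun i => ⟨some i, by simp⟩) (by
    constructor
    · intro a b hab; simpa using hab
    · rintro ⟨_ | i, hi⟩
      · exact absurd rfl hi
      · exact ⟨i, rfl⟩)
  have h2 := pointMeasure_comp_equiv e fun k : {k : Option ℕ // k ≠ none} =>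
    k.1.elim (0 : Plane) fun i => X i ω
  rw [← h2] at h1
  have : IsProbabilityMeasure markLaw := by unfold markLaw; infer_instance
  have h3 : assocGiven m 0 w (pointMeasure fun i => X i ω) =
      markLaw {v | TaggedNotAssoc m (fun i => X i ω) w v}ᶜ := by
    refine h1.symm.trans ?_
    rw [markLaw]
    congr 1
    ext v
    simp only [TaggedNotAssoc, mem_ofPred_eq, mem_compl_iff, not_exists, not_lt, Option.forall,
      Option.elim_none, Option.elim_some, le_refl, true_and]
  rw [h3, prob_compl_eq_one_sub hmS, ENNReal.sub_sub_cancel ENNReal.one_ne_top prob_le_one]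

theorem prod_markLaw_taggedNotAssoc [IsProbabilityMeasure P] (h : IsHPPP P X lam)
    (hlam : 0 ≤ lam) (m : PathLossModel) (w : Plane) :
    (P.prod markLaw) {p | TaggedNotAssoc m (fun i => X i p.1) w p.2} =
      1 - m.assocProb lam ‖w‖ := by
  have : IsProbabilityMeasure markLaw := by unfold markLaw; infer_instance
  have hm : MeasurableSet {p : Ω × (Option ℕ → unitInterval) |
      TaggedNotAssoc m (fun i => X i p.1) w p.2} :=
    (by fun_prop : Measurable fun p : Ω × (Option ℕ → unitInterval) => (p.1, w, p.2))
      (h.measurableSet_taggedNotAssoc m)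
  have hd : dist (0 : Plane) w = ‖w‖ := by rw [dist_comm, dist_zero_right]
  rw [Measure.prod_apply hm, ← hd, ← h.lintegral_assocGiven hlam m 0 w]
  refine (lintegral_congr fun ω => h.markLaw_taggedNotAssoc m w ω).trans ?_
  have hmeas : Measurable fun ω => assocGiven m 0 w (pointMeasure fun i => X i ω) := by
    have h3 : (fun ω => assocGiven m 0 w (pointMeasure fun i => X i ω)) =
        fun ω => 1 - markLaw {v | TaggedNotAssoc m (fun i => X i ω) w v} := by
      ext ω
      rw [h.markLaw_taggedNotAssoc m w ω,
        ENNReal.sub_sub_cancel ENNReal.one_ne_top (assocGiven_le_one _ _ _ _)]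
    rw [h3]
    exact (measurable_measure_prodMk_left hm).const_sub 1
  rw [lintegral_sub hmeas]
  · simp
  · refine ne_top_of_le_ne_top ENNReal.one_ne_top ?_
    calc ∫⁻ ω, assocGiven m 0 w (pointMeasure fun i => X i ω) ∂P ≤ ∫⁻ _, 1 ∂P :=
          lintegral_mono fun ω => assocGiven_le_one _ _ _ _
      _ = 1 := by simp
  · exact ae_of_all _ fun ω => assocGiven_le_one _ _ _ _

theorem taggedProbAt_eq [IsProbabilityMeasure P] (h : IsHPPP P X lam)
    (hlam : 0 ≤ lam) (m : PathLossModel) {w : Plane}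
    (hw : w ≠ 0) : taggedProbAt P m X w = m.notAssocGiven lam ‖w‖ := by
  rw [taggedProbAt, measureReal_def, h.prod_markLaw_taggedNotAssoc hlam,
    m.notAssocGiven_eq hlam (norm_pos_iff.2 hw)]

theorem taggedProbDisk_eq_lintegral [IsProbabilityMeasure P] (h : IsHPPP P X lam)
    (hlam : 0 ≤ lam) (m : PathLossModel) {rmax : ℝ} (hr : 0 < rmax) : taggedProbDisk P m X rmax =
      (∫⁻ w in Metric.closedBall (0 : Plane) rmax, (1 - m.assocProb lam ‖w‖)).toReal /
        (Real.pi * rmax ^ 2) := by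
  have : IsProbabilityMeasure markLaw := by unfold markLaw; infer_instance
  have hS := h.measurableSet_taggedNotAssoc m
  set κ : Measure Plane := volume[|Metric.closedBall (0 : Plane) rmax] with hκ
  have hvol : volume (Metric.closedBall (0 : Plane) rmax) =
      ENNReal.ofReal (Real.pi * rmax ^ 2) := by
    rw [EuclideanSpace.volume_closedBall_fin_two, mul_comm, ENNReal.ofReal_mul Real.pi_pos.le,
      ENNReal.ofReal_pow hr.le]
  have hpos : 0 < Real.pi * rmax ^ 2 := by positivity
  have : IsProbabilityMeasure κ := by
    refine cond_isProbabilityMeasure_of_finite ?_ ?_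
    · rw [hvol]; exact (ENNReal.ofReal_pos.2 hpos).ne'
    · rw [hvol]; exact ENNReal.ofReal_ne_top
  have h1 : (P.prod (κ.prod markLaw)) {p | TaggedNotAssoc m (fun i => X i p.1) p.2.1 p.2.2} =
      ∫⁻ w, (1 - m.assocProb lam ‖w‖) ∂κ := by
    have hm4 : Measurable fun q : Ω × Plane =>
        markLaw {v | TaggedNotAssoc m (fun i => X i q.1) q.2 v} :=
      measurable_measure_prodMk_left ((by fun_prop :
        Measurable fun q : (Ω × Plane) × (Option ℕ → unitInterval) => (q.1.1, q.1.2, q.2)) hS)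
    rw [Measure.prod_apply hS]
    have h2 (ω : Ω) : (κ.prod markLaw) (Prod.mk ω ⁻¹'
        {p | TaggedNotAssoc m (fun i => X i p.1) p.2.1 p.2.2}) =
          ∫⁻ w, markLaw {v | TaggedNotAssoc m (fun i => X i ω) w v} ∂κ := by
      rw [Measure.prod_apply (measurable_prodMk_left hS)]
      rfl
    simp_rw [h2]
    rw [lintegral_lintegral_swap hm4.aemeasurable]
    refine lintegral_congr fun w => ?_
    rw [← h.prod_markLaw_taggedNotAssoc hlam m w, Measure.prod_apply]
    · rfl
    · exact (by fun_prop : Measurable fun p : Ω × (Option ℕ → unitInterval) => (p.1, w, p.2)) hS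
  rw [taggedProbDisk, measureReal_def, h1, hκ, ProbabilityTheory.cond, lintegral_smul_measure,
    smul_eq_mul, ENNReal.toReal_mul, hvol, ENNReal.toReal_inv, ENNReal.toReal_ofReal hpos.le,
    div_eq_inv_mul]

end IsHPPP

theorem PathLossModel.notAssoc_eq_lintegral (m : PathLossModel) {lam : ℝ} (hlam : 0 ≤ lam)
    {rmax : ℝ} (hr : 0 < rmax) : m.notAssoc lam rmax =
      (∫⁻ w in Metric.closedBall (0 : Plane) rmax, (1 - m.assocProb lam ‖w‖)).toReal /
        (Real.pi * rmax ^ 2) := by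
  have hm := (m.measurable_assocProb lam).const_sub 1
  have h1 : ∫⁻ w in Metric.closedBall (0 : Plane) rmax, (1 - m.assocProb lam ‖w‖) =
      ∫⁻ r in Ioc 0 rmax, ENNReal.ofReal (2 * Real.pi * r) * (1 - m.assocProb lam r) := by
    rw [← lintegral_indicator Metric.isClosed_closedBall.measurableSet]
    have h2 := lintegral_fun_norm_plane (hm.indicator (measurableSet_Iic (a := rmax)))
    have h3 (x : Plane) : (Iic rmax).indicator (fun r => 1 - m.assocProb lam r) ‖x‖ =
        (Metric.closedBall (0 : Plane) rmax).indicator (fun w => 1 - m.assocProb lam ‖w‖) x := by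
      by_cases hx : ‖x‖ ≤ rmax
      · rw [indicator_of_mem (show ‖x‖ ∈ Iic rmax from hx),
          indicator_of_mem (mem_closedBall_zero_iff.2 hx)]
      · rw [indicator_of_notMem (show ‖x‖ ∉ Iic rmax from hx),
          indicator_of_notMem (mt mem_closedBall_zero_iff.1 hx)]
    simp_rw [h3] at h2
    rw [h2, ← Ioi_inter_Iic, inter_comm, ← setLIntegral_indicator measurableSet_Iic]
    refine setLIntegral_congr_fun measurableSet_Ioi fun r hr => ?_
    by_cases hx : r ≤ rmax
    · simp [hx]
    · simp [hx]
  rw [h1, PathLossModel.notAssoc, intervalIntegral_eq_toReal_lintegral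
    (F := fun r => (ENNReal.ofReal (2 * Real.pi * r) * (1 - m.assocProb lam r)) *
      ENNReal.ofReal (Real.pi * rmax ^ 2)⁻¹) (by fun_prop) _ _ hr.le,
    lintegral_mul_const _ (by fun_prop), ENNReal.toReal_mul, ENNReal.toReal_ofReal (by positivity),
    div_eq_mul_inv]
  · intro r hr
    rw [m.notAssocGiven_eq hlam hr]
    positivity
  · intro r hr
    rw [m.notAssocGiven_eq hlam hr, ENNReal.ofReal_mul ENNReal.toReal_nonneg,
      ENNReal.ofReal_toReal (ne_top_of_le_ne_top ENNReal.one_ne_top tsub_le_self),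
      mul_comm (ENNReal.ofReal _) (1 - m.assocProb lam r), mul_assoc,
      ← ENNReal.ofReal_mul (by positivity)]
    congr 2
    field_simp

/-! ### Configurations as an s-finite kernel

The joint measurability of `∫ f (x, z) dμ(z)` in `x` and `μ` needs a kernel that is s-finite. The
identity `μ ↦ μ` on all measures is not, but it agrees with an s-finite kernel on the measures
which are finite on balls. -/

/-- The annulus of the points with `k - 1 ≤ ‖z‖ < k`, as a difference of consecutive balls. -/
noncomputable def annulus (k : ℕ) : Set Plane :=
  disjointed (fun n : ℕ => Metric.ball (0 : Plane) n) k

theorem measurableSet_annulus (k : ℕ) : MeasurableSet (annulus k) :=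
  MeasurableSet.disjointed (fun _ => Metric.isOpen_ball.measurableSet) k

theorem annulus_subset_ball (k : ℕ) : annulus k ⊆ Metric.ball 0 k := disjointed_subset _ k

theorem measure_eq_tsum_annulus (μ : Measure Plane) {B : Set Plane} (hB : MeasurableSet B) :
    ∑' k, μ (B ∩ annulus k) = μ B := by
  rw [← measure_iUnion]
  · rw [← inter_iUnion]
    unfold annulus
    rw [iUnion_disjointed, Metric.iUnion_ball_nat, inter_univ]
  · intro a b hab
    exact (disjoint_disjointed _ hab).mono inter_subset_right inter_subset_right
  · exact fun k => hB.inter (measurableSet_annulus k)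

/-- The part on the annulus `p.1` of a measure whose mass there lies in `[p.2, p.2 + 1)`. -/
noncomputable def cutoffKernel (p : ℕ × ℕ) : Kernel (Measure Plane) Plane where
  toFun := {μ | μ (annulus p.1) ∈ Ico (p.2 : ℝ≥0∞) (p.2 + 1)}.indicator
    fun μ => μ.restrict (annulus p.1)
  measurable' := by
    refine Measurable.indicator (Measure.measurable_of_measurable_coe _ fun B hB => ?_)
      (Measure.measurable_coe (measurableSet_annulus p.1) measurableSet_Ico)
    simp_rw [Measure.restrict_apply hB]
    exact Measure.measurable_coe (hB.inter (measurableSet_annulus p.1))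

theorem cutoffKernel_apply_of_mem {p : ℕ × ℕ} {μ : Measure Plane}
    (h : μ (annulus p.1) ∈ Ico (p.2 : ℝ≥0∞) (p.2 + 1)) :
    cutoffKernel p μ = μ.restrict (annulus p.1) :=
  indicator_of_mem (s := {μ : Measure Plane | μ (annulus p.1) ∈ Ico (p.2 : ℝ≥0∞) (p.2 + 1)}) h _

theorem cutoffKernel_apply_of_notMem {p : ℕ × ℕ} {μ : Measure Plane}
    (h : μ (annulus p.1) ∉ Ico (p.2 : ℝ≥0∞) (p.2 + 1)) : cutoffKernel p μ = 0 :=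
  indicator_of_notMem (s := {μ : Measure Plane | μ (annulus p.1) ∈ Ico (p.2 : ℝ≥0∞) (p.2 + 1)}) h _

instance (p : ℕ × ℕ) : IsFiniteKernel (cutoffKernel p) where
  exists_univ_le := by
    refine ⟨p.2 + 1, by simp [ENNReal.add_lt_top], fun μ => ?_⟩
    by_cases h : μ (annulus p.1) ∈ Ico (p.2 : ℝ≥0∞) (p.2 + 1)
    · rw [cutoffKernel_apply_of_mem h, Measure.restrict_apply_univ]; exact h.2.le
    · rw [cutoffKernel_apply_of_notMem h]; simp

/-- An s-finite kernel that leaves a measure which is finite on balls unchanged: on each annulus,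
it keeps the measure if its mass there is finite and replaces it by zero otherwise. -/
noncomputable def configKernel : Kernel (Measure Plane) Plane := Kernel.sum cutoffKernel

instance : IsSFiniteKernel configKernel := by
  unfold configKernel; infer_instance

theorem exists_forall_mem_Ico_natCast_iff {x : ℝ≥0∞} (hx : x ≠ ⊤) :
    ∃ n₀ : ℕ, ∀ n : ℕ, x ∈ Ico (n : ℝ≥0∞) (n + 1) ↔ n = n₀ := by
  lift x to NNReal using hx
  refine ⟨⌊x⌋₊, fun n => ?_⟩
  rw [mem_Ico, eq_comm, Nat.floor_eq_iff (zero_le (a := x))]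
  norm_cast

theorem configKernel_apply {μ : Measure Plane} (hμ : ∀ k : ℕ, μ (Metric.ball 0 k) ≠ ⊤) :
    configKernel μ = μ := by
  ext B hB
  rw [configKernel, Kernel.sum_apply, Measure.sum_apply _ hB, ENNReal.tsum_prod',
    ← measure_eq_tsum_annulus μ hB]
  refine tsum_congr fun k => ?_
  have hfin : μ (annulus k) ≠ ⊤ := ne_top_of_le_ne_top (hμ k) (measure_mono (annulus_subset_ball k))
  obtain ⟨n₀, hn₀⟩ := exists_forall_mem_Ico_natCast_iff hfin
  rw [tsum_eq_single n₀]
  · have h := cutoffKernel_apply_of_mem (p := (k, n₀)) (μ := μ) ((hn₀ n₀).2 rfl)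
    rw [h, Measure.restrict_apply hB]
  · intro n hn
    have h := cutoffKernel_apply_of_notMem (p := (k, n)) (μ := μ) (mt (hn₀ n).1 hn)
    rw [h, Measure.coe_zero, Pi.zero_apply]

/-! ### The activation probability -/

/-- The conditional probability that a BS at `x` is activated, given that the other BSs are the
atoms of `μ` and the UEs have intensity `rho`. -/
noncomputable def activationProb (m : PathLossModel) (rho : ℝ) (x : Plane) (μ : Measure Plane) :
    ℝ≥0∞ :=
  1 - expNeg (ENNReal.ofReal rho * ∫⁻ y, assocGiven m x y μ)

theorem measurable_assocGiven_configKernel (m : PathLossModel) :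
    Measurable fun q : (Plane × Measure Plane) × Plane =>
      assocGiven m q.1.1 q.2 (configKernel q.1.2) := by
  unfold assocGiven
  have hk : Measurable fun a : ((Plane × Measure Plane) × Plane) × unitInterval => a.1.1.2 := by
    fun_prop
  have h : Measurable fun a : ((Plane × Measure Plane) × Plane) × unitInterval =>
      ∫⁻ z, negLog (linkBelow m (linkGain m a.1.1.1 a.1.2 a.2) z a.1.2)
        ∂(configKernel.comap _ hk a) := by
    refine Measurable.lintegral_kernel_prod_right'
      (f := fun b : (((Plane × Measure Plane) × Plane) × unitInterval) × Plane =>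
        negLog (linkBelow m (linkGain m b.1.1.1.1 b.1.1.2 b.1.2) b.2 b.1.1.2)) ?_
    exact (Measurable.linkBelow m (Measurable.linkGain m (by fun_prop) (by fun_prop) (by fun_prop))
      (by fun_prop) (by fun_prop)).negLog
  simp only [Kernel.comap_apply] at h
  exact (Measurable.lintegral_prod_right' h.expNeg)

theorem measurable_activationProb_configKernel (m : PathLossModel) (rho : ℝ) :
    Measurable fun p : Plane × Measure Plane => activationProb m rho p.1 (configKernel p.2) := by
  unfold activationProb
  have h : Measurable fun p : Plane × Measure Plane =>
      ∫⁻ y, assocGiven m p.1 y (configKernel p.2) :=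
    Measurable.lintegral_prod_right' (measurable_assocGiven_configKernel m)
  exact (h.const_mul _).expNeg.const_sub 1

theorem Measurable.assocGiven_configKernel {α : Type*} [MeasurableSpace α] (m : PathLossModel)
    {x y : α → Plane} {μ : α → Measure Plane} (hx : Measurable x) (hy : Measurable y)
    (hμ : Measurable μ) : Measurable fun a => assocGiven m (x a) (y a) (configKernel (μ a)) := by
  have h := (measurable_assocGiven_configKernel m).comp ((hx.prodMk hμ).prodMk hy)
  unfold Function.comp at h
  exact h

theorem Measurable.activationProb_configKernel {α : Type*} [MeasurableSpace α] (m : PathLossModel)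
    (rho : ℝ) {x : α → Plane} {μ : α → Measure Plane} (hx : Measurable x) (hμ : Measurable μ) :
    Measurable fun a => activationProb m rho (x a) (configKernel (μ a)) := by
  have h := (measurable_activationProb_configKernel m rho).comp (hx.prodMk hμ)
  unfold Function.comp at h
  exact h

/-! ### Jensen's inequality and the limit `Q^off` -/

/-- Jensen's inequality for `t ↦ exp (-t)`. -/
theorem expNeg_lintegral_le {Ω : Type*} [MeasurableSpace Ω] {P : Measure Ω} [IsProbabilityMeasure P]
    {W : Ω → ℝ≥0∞} (hW : Measurable W) :
    expNeg (∫⁻ ω, W ω ∂P) ≤ ∫⁻ ω, expNeg (W ω) ∂P := by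
  rcases eq_or_ne (∫⁻ ω, W ω ∂P) ⊤ with h | h
  · rw [h, expNeg_top]; exact zero_le
  set w := (∫⁻ ω, W ω ∂P).toReal with hw
  have hw0 : 0 ≤ w := ENNReal.toReal_nonneg
  have hWw : ∫⁻ ω, W ω ∂P = ENNReal.ofReal w := (ENNReal.ofReal_toReal h).symm
  set a := ENNReal.ofReal (Real.exp (-w)) with ha
  -- the tangent line of `exp (-t)` at `t = w` lies below the graph
  have hpt (t : ℝ≥0∞) : a + a * ENNReal.ofReal w ≤ expNeg t + a * t := by
    rcases eq_or_ne t ⊤ with ht | ht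
    · rw [ht, ENNReal.mul_top (by simpa [ha] using Real.exp_pos _)]; simp
    obtain ⟨s, hs0, rfl⟩ : ∃ s : ℝ, 0 ≤ s ∧ t = ENNReal.ofReal s :=
      ⟨t.toReal, ENNReal.toReal_nonneg, (ENNReal.ofReal_toReal ht).symm⟩
    have he := Real.exp_pos (-w)
    rw [expNeg_ofReal hs0, ha, ← ENNReal.ofReal_mul he.le, ← ENNReal.ofReal_mul he.le,
      ← ENNReal.ofReal_add he.le (by positivity), ← ENNReal.ofReal_add (Real.exp_pos _).le
        (by positivity)]
    refine ENNReal.ofReal_le_ofReal ?_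
    have h1 : Real.exp (-s) = Real.exp (-w) * Real.exp (w - s) := by rw [← Real.exp_add]; ring_nf
    have h2 := Real.add_one_le_exp (w - s)
    rw [h1]
    nlinarith
  have hint := lintegral_mono (μ := P) fun ω => hpt (W ω)
  rw [lintegral_const, measure_univ, mul_one, lintegral_add_left hW.expNeg,
    lintegral_const_mul _ hW, hWw] at hint
  rw [hWw, expNeg_ofReal hw0]
  exact (ENNReal.add_le_add_iff_right (ENNReal.mul_ne_top ENNReal.ofReal_ne_top
    ENNReal.ofReal_ne_top)).1 hint

namespace PathLossModel

variable (m : PathLossModel) {lam rho : ℝ}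

/-- The probability generating function of a Poisson variable of mean `a`, at `p`. -/
theorem tsum_poisson_eq (a p : ℝ) :
    ∑' k : ℕ, p ^ k * (a ^ k * Real.exp (-a) / k.factorial) = Real.exp (-(a * (1 - p))) := by
  have h := (NormedSpace.expSeries_div_hasSum_exp (a * p)).mul_left (Real.exp (-a))
  rw [← Real.exp_eq_exp_ℝ, ← Real.exp_add] at h
  have e1 : -(a * (1 - p)) = -a + a * p := by ring
  rw [e1, ← h.tsum_eq]
  refine tsum_congr fun k => ?_
  rw [mul_pow]; ring

theorem qOff_eq (hlam : 0 ≤ lam) (hrho : 0 ≤ rho) {rmax : ℝ} (hr : 0 < rmax) :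
    m.qOff lam rho rmax = (expNeg (ENNReal.ofReal rho *
      ∫⁻ w in Metric.closedBall (0 : Plane) rmax, m.assocProb lam ‖w‖)).toReal := by
  have hm : Measurable fun w : Plane => m.assocProb lam ‖w‖ :=
    (m.measurable_assocProb lam).comp measurable_norm
  have hvol : volume.real (Metric.closedBall (0 : Plane) rmax) = Real.pi * rmax ^ 2 := by
    rw [measureReal_def, EuclideanSpace.volume_closedBall_fin_two, ENNReal.toReal_mul,
      ENNReal.toReal_pow, ENNReal.toReal_ofReal hr.le]
    simp [mul_comm, Real.pi_pos.le]
  have hballfin : volume (Metric.closedBall (0 : Plane) rmax) ≠ ⊤ := measure_closedBall_lt_top.ne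
  have hle : ∫⁻ w in Metric.closedBall (0 : Plane) rmax, m.assocProb lam ‖w‖ ≤
      volume (Metric.closedBall (0 : Plane) rmax) := by
    rw [← setLIntegral_one]
    exact lintegral_mono fun w => m.assocProb_le_one _ _
  have hfin := ne_top_of_le_ne_top hballfin hle
  have hsub : (∫⁻ w in Metric.closedBall (0 : Plane) rmax, (1 - m.assocProb lam ‖w‖)).toReal =
      Real.pi * rmax ^ 2 -
        (∫⁻ w in Metric.closedBall (0 : Plane) rmax, m.assocProb lam ‖w‖).toReal := by
    rw [lintegral_sub hm hfin (ae_of_all _ fun w => m.assocProb_le_one _ _), setLIntegral_one,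
      ENNReal.toReal_sub_of_le hle hballfin, ← measureReal_def, hvol]
  have hpos : 0 < Real.pi * rmax ^ 2 := by positivity
  rw [qOff, tsum_poisson_eq, m.notAssoc_eq_lintegral hlam hr, hsub,
    expNeg_eq_ofReal (ENNReal.mul_ne_top ENNReal.ofReal_ne_top hfin),
    ENNReal.toReal_ofReal (Real.exp_pos _).le, ENNReal.toReal_mul, ENNReal.toReal_ofReal hrho]
  congr 2
  field_simp
  ring

/-- By monotone convergence the mean number of associated UEs in the disk converges to the one in
the plane, which may be infinite; `Q^off` is then `0`. -/
theorem tendsto_qOff (hlam : 0 ≤ lam) (hrho : 0 ≤ rho) :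
    Tendsto (fun rmax => m.qOff lam rho rmax) atTop
      (𝓝 (expNeg (ENNReal.ofReal rho * ∫⁻ w : Plane, m.assocProb lam ‖w‖)).toReal) := by
  have h1 : Tendsto (fun r : ℝ => ∫⁻ w in Metric.closedBall (0 : Plane) r, m.assocProb lam ‖w‖)
      atTop (𝓝 (∫⁻ w : Plane, m.assocProb lam ‖w‖)) := by
    have h2 := tendsto_measure_iUnion_atTop
      (μ := (volume : Measure Plane).withDensity fun w => m.assocProb lam ‖w‖)
      (s := fun r : ℝ => Metric.closedBall (0 : Plane) r)
      fun _ _ h => Metric.closedBall_subset_closedBall h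
    have h3 : ⋃ r : ℝ, Metric.closedBall (0 : Plane) r = univ :=
      eq_univ_of_forall fun x => mem_iUnion.2 ⟨dist x 0, Metric.mem_closedBall.2 le_rfl⟩
    rw [h3, withDensity_apply _ MeasurableSet.univ, setLIntegral_univ] at h2
    exact h2.congr fun r => withDensity_apply _ Metric.isClosed_closedBall.measurableSet
  have h2 := (ENNReal.tendsto_toReal (expNeg_ne_top _)).comp ((continuous_expNeg.tendsto _).comp
    (ENNReal.Tendsto.const_mul h1 (Or.inr (ENNReal.ofReal_ne_top (r := rho)))))
  refine h2.congr' ?_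
  filter_upwards [eventually_gt_atTop 0] with r hr
  exact (m.qOff_eq hlam hrho hr).symm

end PathLossModel

/-! ### Association and activation in the network -/

theorem measurable_assocGiven_pointMeasure (m : PathLossModel) (x : Plane) {ι : Type*} [Countable ι]
    (b : ι → Plane) : Measurable fun y => assocGiven m x y (pointMeasure b) := by
  simp_rw [assocGiven_pointMeasure]
  refine Measurable.lintegral_prod_right' (f := fun p : Plane × unitInterval =>
    expNeg (∑' k, negLog (linkBelow m (linkGain m x p.1 p.2) (b k) p.1))) ?_
  refine (Measurable.tsum fun k => ?_).expNeg
  exact (Measurable.linkBelow m (.linkGain m measurable_const measurable_fst measurable_snd)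
    measurable_const measurable_fst).negLog

theorem linkGain_sub_right (m : PathLossModel) (x y a : Plane) (u : unitInterval) :
    linkGain m (x - a) (y - a) u = linkGain m x y u := by
  rw [linkGain, linkGain, dist_sub_right]

theorem assocGiven_sub_right (m : PathLossModel) (x y a : Plane) {ι : Type*} (b : ι → Plane) :
    assocGiven m (x - a) (y - a) (pointMeasure fun k => b k - a) =
      assocGiven m x y (pointMeasure b) := by
  simp_rw [assocGiven_pointMeasure, linkBelow, linkGain_sub_right]

theorem activationProb_sub_right (m : PathLossModel) (rho : ℝ) (x a : Plane) {ι : Type*}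
    (b : ι → Plane) : activationProb m rho (x - a) (pointMeasure fun k => b k - a) =
      activationProb m rho x (pointMeasure b) := by
  rw [activationProb, activationProb, ← lintegral_sub_right_eq_self
    (fun y => assocGiven m (x - a) y (pointMeasure fun k => b k - a)) a]
  simp_rw [assocGiven_sub_right]

/-- Given the positions of all BSs and UEs, the associations of different UEs are independent. -/
theorem infinitePi_exists_assoc (m : PathLossModel) (x y : ℕ → Plane) (i : ℕ) :
    (Measure.infinitePi fun _ : ℕ =>
      Measure.infinitePi fun _ : ℕ => (volume : Measure unitInterval))
      {v | ∃ j, ∀ k, linkGain m (x k) (y j) (v j k) ≤ linkGain m (x i) (y j) (v j i)} =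
      1 - expNeg (∑' j, negLog
        (1 - assocGiven m (x i) (y j) (pointMeasure fun k : {k // k ≠ i} => x k))) := by
  let T : ℕ → Set (ℕ → unitInterval) := fun j =>
    {v | ∀ k, linkGain m (x k) (y j) (v k) ≤ linkGain m (x i) (y j) (v i)}
  have hT (j : ℕ) : MeasurableSet (T j) := by
    have : T j = ⋂ k, {v | linkGain m (x k) (y j) (v k) ≤ linkGain m (x i) (y j) (v i)} := by
      ext v; simp [T]
    rw [this]
    exact MeasurableSet.iInter fun k => measurableSet_le
      (.linkGain m measurable_const measurable_const (measurable_pi_apply k))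
      (.linkGain m measurable_const measurable_const (measurable_pi_apply i))
  have hS : {v : ℕ → ℕ → unitInterval | ∃ j, ∀ k,
      linkGain m (x k) (y j) (v j k) ≤ linkGain m (x i) (y j) (v j i)} =
      (univ.pi fun j => (T j)ᶜ)ᶜ := by
    ext v
    simp only [mem_compl_iff, mem_univ_pi, not_forall, not_not]
    rfl
  rw [hS, prob_compl_eq_one_sub (MeasurableSet.univ_pi fun j => (hT j).compl),
    infinitePi_univ_pi _ fun j => (hT j).compl]
  congr 3
  ext j
  rw [prob_compl_eq_one_sub (hT j), infinitePi_forall_linkGain_le m i x (y j)]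

namespace IsHPPP

variable {Ω : Type*} [MeasurableSpace Ω] {P : Measure Ω} {X : ℕ → Ω → Plane} {lam : ℝ}

theorem ae_pointMeasure_ball_ne_top (h : IsHPPP P X lam) :
    ∀ᵐ ω ∂P, ∀ k : ℕ, pointMeasure (fun i => X i ω) (Metric.ball 0 k) ≠ ⊤ := by
  refine ae_all_iff.2 fun k => ?_
  have hb : MeasurableSet (Metric.ball (0 : Plane) k) := Metric.isOpen_ball.measurableSet
  have h1 : P.map (pointCount X (Metric.ball 0 k)) {⊤} = 0 := by
    rw [h.map_pointCount _ hb measure_ball_lt_top.ne, poissonMeasure_map_cast_top]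
  rw [Measure.map_apply (h.measurable_pointCount hb) (measurableSet_singleton _)] at h1
  filter_upwards [measure_eq_zero_iff_ae_notMem.1 h1] with ω hω htop
  rw [pointMeasure_apply _ hb] at htop
  exact hω (ENat.toENNReal_eq_top.1 htop)

theorem ae_configKernel_eq (h : IsHPPP P X lam) : ∀ᵐ ω ∂P,
    configKernel (pointMeasure fun i => X i ω) = pointMeasure fun i => X i ω := by
  filter_upwards [h.ae_pointMeasure_ball_ne_top] with ω hω using configKernel_apply hω

theorem ae_configKernel_reduced_eq (h : IsHPPP P X lam) (i : ℕ) : ∀ᵐ ω ∂P,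
    configKernel (pointMeasure fun k : {k // k ≠ i} => X k ω) =
      pointMeasure fun k : {k // k ≠ i} => X k ω := by
  filter_upwards [h.ae_pointMeasure_ball_ne_top] with ω hω
  refine configKernel_apply fun k => ne_top_of_le_ne_top (hω k) ?_
  rw [pointMeasure_eq_dirac_add (fun i => X i ω) i, Measure.add_apply]
  exact le_add_self

/-- By stationarity, an additional BS is activated with the same probability at any place. -/
theorem lintegral_activationProb_eq_origin [IsProbabilityMeasure P] (h : IsHPPP P X lam)
    (m : PathLossModel) (rho : ℝ) (x : Plane) :
    ∫⁻ ω, activationProb m rho x (configKernel (pointMeasure fun i => X i ω)) ∂P =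
      ∫⁻ ω, activationProb m rho 0 (pointMeasure fun i => X i ω) ∂P := by
  have hm : Measurable fun μ : Measure Plane => activationProb m rho 0 (configKernel μ) :=
    Measurable.activationProb_configKernel m rho measurable_const measurable_id
  have ht := h.translate x
  calc ∫⁻ ω, activationProb m rho x (configKernel (pointMeasure fun i => X i ω)) ∂P
      = ∫⁻ ω, activationProb m rho 0 (configKernel (pointMeasure fun i => X i ω - x)) ∂P := by
        refine lintegral_congr_ae ?_
        filter_upwards [h.ae_configKernel_eq, ht.ae_configKernel_eq] with ω h1 h2
        rw [h1, h2, ← activationProb_sub_right m rho x x, sub_self]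
    _ = ∫⁻ ω, activationProb m rho 0 (configKernel (pointMeasure fun i => X i ω)) ∂P := by
        rw [← lintegral_map hm ht.measurable_pointMeasure, ht.map_pointMeasure_eq h,
          lintegral_map hm h.measurable_pointMeasure]
    _ = _ := by
        refine lintegral_congr_ae ?_
        filter_upwards [h.ae_configKernel_eq] with ω h1
        rw [h1]

/-- Jensen's inequality for the mean number of UEs associated with a BS at the origin. -/
theorem lintegral_activationProb_le [IsProbabilityMeasure P] (h : IsHPPP P X lam)
    (hlam : 0 ≤ lam) (m : PathLossModel) (rho : ℝ) :
    ∫⁻ ω, activationProb m rho 0 (pointMeasure fun i => X i ω) ∂P ≤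
      1 - expNeg (ENNReal.ofReal rho * ∫⁻ w : Plane, m.assocProb lam ‖w‖) := by
  let A : Ω → Plane → ℝ≥0∞ := fun ω y =>
    assocGiven m 0 y (configKernel (pointMeasure fun i => X i ω))
  have hA : Measurable (Function.uncurry A) :=
    Measurable.assocGiven_configKernel m measurable_const measurable_snd
      (h.measurable_pointMeasure.comp measurable_fst)
  have hI : Measurable fun ω => ∫⁻ y, A ω y := Measurable.lintegral_prod_right' hA
  have hW : Measurable fun ω => ENNReal.ofReal rho * ∫⁻ y, A ω y := hI.const_mul _
  have hmean : ∫⁻ ω, (ENNReal.ofReal rho * ∫⁻ y, A ω y) ∂P =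
      ENNReal.ofReal rho * ∫⁻ w : Plane, m.assocProb lam ‖w‖ := by
    rw [lintegral_const_mul _ hI,
      lintegral_lintegral_swap hA.aemeasurable]
    congr 1
    refine lintegral_congr fun w => ?_
    rw [← dist_zero_left w, ← h.lintegral_assocGiven hlam m 0 w]
    refine lintegral_congr_ae ?_
    filter_upwards [h.ae_configKernel_eq] with ω h1
    simp only [A, h1]
  calc ∫⁻ ω, activationProb m rho 0 (pointMeasure fun i => X i ω) ∂P
      = ∫⁻ ω, (1 - expNeg (ENNReal.ofReal rho * ∫⁻ y, A ω y)) ∂P := by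
        refine lintegral_congr_ae ?_
        filter_upwards [h.ae_configKernel_eq] with ω h1
        simp only [A, h1, activationProb]
    _ = 1 - ∫⁻ ω, expNeg (ENNReal.ofReal rho * ∫⁻ y, A ω y) ∂P := by
        rw [lintegral_sub hW.expNeg _ (ae_of_all _ fun ω => expNeg_le_one _)]
        · simp
        · refine ne_top_of_le_ne_top ENNReal.one_ne_top
            ((lintegral_mono fun ω => expNeg_le_one _).trans (by simp))
    _ ≤ _ := by
        rw [← hmean]
        exact tsub_le_tsub_left (expNeg_lintegral_le hW) 1

/-- Averaging over the UEs: by their Laplace functional, a BS at `x` is chosen by some UE with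
probability `activationProb`. -/
theorem lintegral_one_sub_expNeg_assocGiven [IsProbabilityMeasure P] {Y : ℕ → Ω → Plane} {rho : ℝ}
    (h : IsHPPP P Y rho) (hrho : 0 ≤ rho) (m : PathLossModel) (x : Plane) {ι : Type*} [Countable ι]
    (b : ι → Plane) :
    ∫⁻ ω, (1 - expNeg (∑' j, negLog (1 - assocGiven m x (Y j ω) (pointMeasure b)))) ∂P =
      activationProb m rho x (pointMeasure b) := by
  have ht : Measurable fun y => negLog (1 - assocGiven m x y (pointMeasure b)) :=
    ((measurable_assocGiven_pointMeasure m x b).const_sub 1).negLog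
  have h1 := h.lintegral_expNeg hrho ht
  simp_rw [lintegral_pointMeasure _ ht, expNeg_negLog tsub_le_self,
    ENNReal.sub_sub_cancel ENNReal.one_ne_top (assocGiven_le_one m x _ _)] at h1
  rw [lintegral_sub _ _ (ae_of_all _ fun ω => expNeg_le_one _), h1, activationProb]
  · simp
  · exact (Measurable.tsum fun j => ht.comp (h.measurable j)).expNeg
  · rw [h1]; exact expNeg_ne_top _

end IsHPPP

namespace IsNetwork

variable {Ω : Type*} [MeasurableSpace Ω] {P : Measure Ω} {lam rho : ℝ}
  {X Y : ℕ → Ω → Plane} {U : ℕ → ℕ → Ω → unitInterval}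

/-- The marks grouped by UE: the families of marks of different UEs are independent. -/
theorem map_mark (h : IsNetwork P lam rho X Y U) :
    P.map (fun ω j i => U i j ω) = Measure.infinitePi fun _ : ℕ =>
      Measure.infinitePi fun _ : ℕ => (volume : Measure unitInterval) := by
  have h1 := (h.mark_indep.precomp Prod.swap_injective).map_fun_eq_infinitePi_map
    fun p => h.mark_measurable _ _
  simp only [h.mark_uniform] at h1
  rw [← Measure.infinitePi_map_curry fun _ _ : ℕ => (volume : Measure unitInterval), ← h1,
    Measure.map_map (by fun_prop) (measurable_pi_iff.2 fun p => h.mark_measurable _ _)]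
  rfl

theorem map_positions_mark [IsProbabilityMeasure P] (h : IsNetwork P lam rho X Y U) :
    P.map (fun ω => (((fun i => X i ω), (fun j => Y j ω)), fun j i => U i j ω)) =
      ((P.map fun ω i => X i ω).prod (P.map fun ω j => Y j ω)).prod
        (Measure.infinitePi fun _ : ℕ =>
          Measure.infinitePi fun _ : ℕ => (volume : Measure unitInterval)) := by
  have hX : Measurable fun ω i => X i ω := measurable_pi_iff.2 h.bs.measurable
  have hY : Measurable fun ω j => Y j ω := measurable_pi_iff.2 h.ue.measurable
  have hU : Measurable fun ω j i => U i j ω :=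
    measurable_pi_iff.2 fun j => measurable_pi_iff.2 fun i => h.mark_measurable i j
  have h1 := h.indep_mark.comp measurable_id
    (ψ := fun (v : ℕ × ℕ → unitInterval) (j i : ℕ) => v (i, j)) (by fun_prop)
  have h2 := (indepFun_iff_map_prod_eq_prod_map_map (hX.prodMk hY).aemeasurable
    hU.aemeasurable).1 h1
  rw [← h.map_mark, ← (indepFun_iff_map_prod_eq_prod_map_map hX.aemeasurable
    hY.aemeasurable).1 h.indep_bs_ue, ← h2]

theorem measure_activated [IsProbabilityMeasure P] (h : IsNetwork P lam rho X Y U)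
    (hrho : 0 ≤ rho) (m : PathLossModel)
    {B : Set Plane} (hB : MeasurableSet B) (i : ℕ) :
    P {ω | X i ω ∈ B ∧ ∃ j, IsAssociated m X Y U ω j i} =
      ∫⁻ ω, B.indicator 1 (X i ω) *
        activationProb m rho (X i ω) (pointMeasure fun k : {k // k ≠ i} => X k ω) ∂P := by
  have hX : Measurable fun ω i => X i ω := measurable_pi_iff.2 h.bs.measurable
  have hY : Measurable fun ω j => Y j ω := measurable_pi_iff.2 h.ue.measurable
  have hU : Measurable fun ω j i => U i j ω :=
    measurable_pi_iff.2 fun j => measurable_pi_iff.2 fun i => h.mark_measurable i j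
  have : IsProbabilityMeasure (P.map fun ω j => Y j ω) :=
    Measure.isProbabilityMeasure_map hY.aemeasurable
  let S : Set (((ℕ → Plane) × (ℕ → Plane)) × (ℕ → ℕ → unitInterval)) :=
    {p | p.1.1 i ∈ B ∧ ∃ j, ∀ k,
      linkGain m (p.1.1 k) (p.1.2 j) (p.2 j k) ≤ linkGain m (p.1.1 i) (p.1.2 j) (p.2 j i)}
  have hS : MeasurableSet S := by
    have e : S = {p | p.1.1 i ∈ B} ∩ ⋃ j, ⋂ k, {p | linkGain m (p.1.1 k) (p.1.2 j) (p.2 j k) ≤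
        linkGain m (p.1.1 i) (p.1.2 j) (p.2 j i)} := by
      ext p; simp [S]
    rw [e]
    refine ((by fun_prop : Measurable fun p : ((ℕ → Plane) × (ℕ → Plane)) ×
      (ℕ → ℕ → unitInterval) => p.1.1 i) hB).inter
      (MeasurableSet.iUnion fun j => MeasurableSet.iInter fun k => ?_)
    exact measurableSet_le (.linkGain m (by fun_prop) (by fun_prop) (by fun_prop))
      (.linkGain m (by fun_prop) (by fun_prop) (by fun_prop))
  set Q := Measure.infinitePi fun _ : ℕ => Measure.infinitePi fun _ : ℕ =>
    (volume : Measure unitInterval)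
  have hQ : Measurable fun q : (ℕ → Plane) × (ℕ → Plane) => Q (Prod.mk q ⁻¹' S) :=
    measurable_measure_prodMk_left hS
  have h1 : P {ω | X i ω ∈ B ∧ ∃ j, IsAssociated m X Y U ω j i} =
      ∫⁻ ω, ∫⁻ ω', Q (Prod.mk ((fun i => X i ω), fun j => Y j ω') ⁻¹' S) ∂P ∂P := by
    calc P {ω | X i ω ∈ B ∧ ∃ j, IsAssociated m X Y U ω j i}
        = P.map (fun ω => (((fun i => X i ω), (fun j => Y j ω)), fun j i => U i j ω)) S := by
          rw [Measure.map_apply ((hX.prodMk hY).prodMk hU) hS]; rfl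
      _ = ∫⁻ x, ∫⁻ y, Q (Prod.mk (x, y) ⁻¹' S) ∂(P.map fun ω j => Y j ω)
            ∂(P.map fun ω i => X i ω) := by
          rw [h.map_positions_mark, Measure.prod_apply hS, lintegral_prod _ hQ.aemeasurable]
      _ = _ := by
          rw [lintegral_map (Measurable.lintegral_prod_right' hQ) hX]
          refine lintegral_congr fun ω => ?_
          exact lintegral_map (hQ.comp measurable_prodMk_left) hY
  rw [h1]
  refine lintegral_congr fun ω => ?_
  by_cases hx : X i ω ∈ B
  · rw [indicator_of_mem hx, Pi.one_apply, one_mul,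
      ← h.ue.lintegral_one_sub_expNeg_assocGiven hrho m (X i ω) fun k : {k // k ≠ i} => X k ω]
    refine lintegral_congr fun ω' => ?_
    rw [← infinitePi_exists_assoc m (fun k => X k ω) (fun j => Y j ω') i]
    congr 1
    ext v
    exact and_iff_right hx
  · rw [indicator_of_notMem hx, zero_mul]
    refine (lintegral_congr fun ω' => ?_).trans lintegral_zero
    convert measure_empty (μ := Q)
    exact eq_empty_of_forall_notMem fun v hv => hx hv.1

theorem measurableSet_activated (h : IsNetwork P lam rho X Y U) (m : PathLossModel)
    {B : Set Plane} (hB : MeasurableSet B) (i : ℕ) :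
    MeasurableSet {ω | X i ω ∈ B ∧ ∃ j, IsAssociated m X Y U ω j i} := by
  have e : {ω | X i ω ∈ B ∧ ∃ j, IsAssociated m X Y U ω j i} =
      X i ⁻¹' B ∩ ⋃ j, ⋂ k, {ω | linkGain m (X k ω) (Y j ω) (U k j ω) ≤
        linkGain m (X i ω) (Y j ω) (U i j ω)} := by
    ext ω; simp [IsAssociated]
  rw [e]
  exact (h.bs.measurable i hB).inter (MeasurableSet.iUnion fun j => MeasurableSet.iInter fun k =>
    measurableSet_le (.linkGain m (h.bs.measurable k) (h.ue.measurable j) (h.mark_measurable k j))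
      (.linkGain m (h.bs.measurable i) (h.ue.measurable j) (h.mark_measurable i j)))

/-- The activated BSs have a constant density, by Mecke's formula and stationarity. -/
theorem lintegral_activatedCount [IsProbabilityMeasure P] (h : IsNetwork P lam rho X Y U)
    (hlam : 0 ≤ lam) (hrho : 0 ≤ rho)
    (m : PathLossModel) {B : Set Plane} (hB : MeasurableSet B) :
    ∫⁻ ω, (activatedCount m X Y U B ω : ℝ≥0∞) ∂P =
      ENNReal.ofReal lam * (∫⁻ ω, activationProb m rho 0 (pointMeasure fun i => X i ω) ∂P) *
        volume B := by
  have hB1 : Measurable (B.indicator (1 : Plane → ℝ≥0∞)) := measurable_one.indicator hB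
  let F : Plane → Measure Plane → ℝ≥0∞ := fun x μ =>
    B.indicator 1 x * activationProb m rho x (configKernel μ)
  have hF : Measurable (Function.uncurry F) :=
    (hB1.comp measurable_fst).mul
      (Measurable.activationProb_configKernel m rho measurable_fst measurable_snd)
  calc ∫⁻ ω, (activatedCount m X Y U B ω : ℝ≥0∞) ∂P
      = ∑' i, P {ω | X i ω ∈ B ∧ ∃ j, IsAssociated m X Y U ω j i} := by
        simp_rw [activatedCount, ← tsum_indicator_one_eq_encard]
        rw [lintegral_tsum]
        · refine tsum_congr fun i => ?_
          rw [← lintegral_indicator_one (h.measurableSet_activated m hB i)]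
          rfl
        · exact fun i => (measurable_one.indicator (h.measurableSet_activated m hB i)).aemeasurable
    _ = ∑' i, ∫⁻ ω, F (X i ω) (pointMeasure fun k : {k // k ≠ i} => X k ω) ∂P := by
        refine tsum_congr fun i => (h.measure_activated hrho m hB i).trans (lintegral_congr_ae ?_)
        filter_upwards [h.bs.ae_configKernel_reduced_eq i] with ω hω
        simp only [F, hω]
    _ = ENNReal.ofReal lam * ∫⁻ x, ∫⁻ ω, F x (pointMeasure fun i => X i ω) ∂P :=
        h.bs.tsum_lintegral_reduced hlam hF
    _ = ENNReal.ofReal lam * ∫⁻ x, B.indicator 1 x *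
          ∫⁻ ω, activationProb m rho 0 (pointMeasure fun i => X i ω) ∂P := by
        congr 1
        refine lintegral_congr fun x => ?_
        rw [← h.bs.lintegral_activationProb_eq_origin m rho x, ← lintegral_const_mul]
        exact Measurable.activationProb_configKernel m rho measurable_const
          h.bs.measurable_pointMeasure
    _ = _ := by
        rw [lintegral_mul_const _ hB1, lintegral_indicator_one hB]
        ring

end IsNetwork

theorem theorem2 {Ω : Type*} [MeasurableSpace Ω] (P : Measure Ω) [IsProbabilityMeasure P]
    (m : PathLossModel) (lam rho : ℝ) (hlam : 0 < lam) (hrho : 0 < rho)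
    (X Y : ℕ → Ω → Plane) (U : ℕ → ℕ → Ω → unitInterval)
    (hnet : IsNetwork P lam rho X Y U) :
    (∀ w : Plane, w ≠ 0 → taggedProbAt P m X w = m.notAssocGiven lam ‖w‖) ∧
    (∀ rmax : ℝ, 0 < rmax → taggedProbDisk P m X rmax = m.notAssoc lam rmax) ∧
    ∃ Qoff : ℝ, Tendsto (fun rmax => m.qOff lam rho rmax) atTop (𝓝 Qoff) ∧
      ∃ lamt : ℝ, IsActivatedDensity P m X Y U lamt ∧ lamt ≤ lam * (1 - Qoff) := by
  refine ⟨fun w hw => hnet.bs.taggedProbAt_eq hlam.le m hw, fun rmax hr => ?_, _,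
    m.tendsto_qOff hlam.le hrho.le,
    lam * (∫⁻ ω, activationProb m rho 0 (pointMeasure fun i => X i ω) ∂P).toReal,
    ⟨by positivity, fun B hB => ?_⟩, ?_⟩
  · rw [hnet.bs.taggedProbDisk_eq_lintegral hlam.le m hr, m.notAssoc_eq_lintegral hlam.le hr]
  · have hfin := ne_top_of_le_ne_top ENNReal.one_ne_top
      ((hnet.bs.lintegral_activationProb_le hlam.le m rho).trans tsub_le_self)
    rw [hnet.lintegral_activatedCount hlam.le hrho.le m hB, ENNReal.ofReal_mul hlam.le,
      ENNReal.ofReal_toReal hfin]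
  · have h1 := ENNReal.toReal_mono
      (ne_top_of_le_ne_top ENNReal.one_ne_top tsub_le_self)
      (hnet.bs.lintegral_activationProb_le hlam.le m rho)
    rw [ENNReal.toReal_sub_of_le (expNeg_le_one _) ENNReal.one_ne_top, ENNReal.toReal_one] at h1
    exact mul_le_mul_of_nonneg_left h1 hlam.le
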